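/- Let $G=C_2=\{e,\sigma\}$. For $0\le k\le n+1$ let $[n]_k$ be the finite $G$-poset $(\{0<\dots<n\}\times G)/{\sim_k}$, where $(i,e)\sim_k(i,\sigma)$ for $i\ge k$, with the induced order and $g\cdot[i,h]=[i,gh]$; the vertices $[i,g]$ with $i\ge k$ are called real, the others non-real. Let $\mathbf{\Delta}_G$ be the category of the $G$-posets $[n]_k$ and isovariant order-preserving maps (order-preserving equivariant maps $f$ with $G_a=G_{f(a)}$ for all $a$). An isovariant simplicial set is a presheaf of sets on $\mathbf{\Delta}_G$; let $\mathcal S$ be the category of these, and let $\Delta^{n,k}$ be the presheaf represented by $[n]_k$. *Horns.* Let $n\ge 1$, $0\le k\le n+1$. For $k\le i\le n$ let $d_0^i:[n-1]_k\to[n]_k$, and for $0\le i<k$ let $d_1^i:[n-1]_{k-1}\to[n]_k$, be the map induced by the usual coface omitting $i$; let $\partial_\varepsilon^i\Delta^{n,k}\subseteq\Delta^{n,k}$ be the image of $d_\varepsilon^i$. Let $s_0^a:[n]_k\to[n-1]_k$ ($k\le a\le n-1$) and $s_1^a:[n]_k\to[n-1]_{k-1}$ ($0\le a<k-1$) be the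 maps induced by the usual codegeneracy identifying $a$ and $a+1$. For $0\le l\le n$ the horn $\Lambda^{n,k}_l\subseteq\Delta^{n,k}$ is the union of all these faces $\partial_\varepsilon^i\Delta^{n,k}$ with $i\ne l$. It is admissible if, for $\varepsilon$ the index such that $d_\varepsilon^l$ exists, there is $a\in\{l-1,l\}$ such that $s_\varepsilon^a$ exists and $d_\varepsilon^l s_\varepsilon^a(\Delta^{n,k})=\partial^l_\varepsilon\Delta^{n,k}$. A morphism of $\mathcal S$ is an isovariant anodyne extension if it belongs to the smallest class of morphisms that contains the admissible horn inclusions $\Lambda^{n,k}_l\to\Delta^{n,k}$ and is closed under retracts, pushouts and transfinite compositions. *Normality.* A simplex $u\in X_{m,l}=X([m]_l)$ is dominant if it is non-degenerate (not of the form $\pi^*v$ with $\pi$ a non-invertible epimorphism of $\mathbf{\Delta}_G$) and no automorphism of $[m]_l$ other than the identity fixes $u$. $X$ is normal if every simplex of $X$ is of the form $\pi^*u$ with $\pi$ an epimorphism of $\mathbf{\Delta}_G$ and $u$ dominant. *Cylinders.* Let $I:\mathcal S\to\mathcal S$ be the left Kan extension along the Yoneda embedding of the functor sending $[n]_k$ to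 the presheaf of isovariant order-preserving maps into $[n]_k\times\{0<1\}$ ($G$ acting trivially on $\{0,1\}$). The inclusions $x\mapsto(x,\varepsilon)$, $\varepsilon=0,1$, and the projection $[n]_k\times\{0<1\}\to[n]_k$ induce natural maps $\partial_0,\partial_1:X\to IX$ and $\rho:IX\to X$ with $\rho\partial_\varepsilon=\mathrm{id}$. For an isovariant simplicial set $B$, the functor $I_B$ on $\mathcal S\downarrow B$ sends $p:X\to B$ to $IX$ with structural map $\rho^B\circ I(p)$, with the maps $\partial_0,\partial_1,\rho$ of $X$. For $J=I$ or $J=I_B$ put $\partial J(X)=X\amalg X$, with the map $(\partial_0,\partial_1):\partial J(X)\to JX$; for $f:K\to L$ write $JK\cup\partial J(L)$ for the pushout $JK\amalg_{\partial J(K)}\partial J(L)$ and $JK\cup\{\varepsilon\}L$ for the pushout $JK\amalg_{K}L$ along $\partial_\varepsilon:K\to JK$ and $f$; both map canonically to $JL$. **Statement.** (1) Let $B$ be a normal isovariant simplicial set, and let $\mathrm{An}_B$ be the class of morphisms of $\mathcal S\downarrow B$ whose underlying morphism in $\mathcal S$ is an isovariant anodyne extension. Then $\mathrm{An}_B$ is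 a class of $I_B$-anodyne extensions in the sense of Cisinski, that is: * An0. There is a small set $S$ of monomorphisms of $\mathcal S\downarrow B$ such that $\mathrm{An}_B$ is the class of morphisms having the left lifting property with respect to all morphisms that have the right lifting property with respect to $S$. * An1. For every monomorphism $K\to L$ of $\mathcal S\downarrow B$ and $\varepsilon=0,1$, the canonical map $I_BK\cup\{\varepsilon\}L\to I_BL$ is in $\mathrm{An}_B$. * An2. For every $K\to L$ in $\mathrm{An}_B$, the canonical map $I_BK\cup\partial I_B(L)\to I_BL$ is in $\mathrm{An}_B$. (2) For every isovariant anodyne extension $X\to Y$ in $\mathcal S$ (with no normality assumption), the canonical map $IX\cup\partial I(Y)\to IY$ is an isovariant anodyne extension. -/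

import Mathlib

open CategoryTheory CategoryTheory.Limits Opposite

namespace Isov

/-! ## The isovariant simplex category -/

/-- The cyclic group `G = C₂` of order two. -/
abbrev C2 : Type := Multiplicative (ZMod 2)

/-- Finite `G`-posets: finite posets with an action of `G` by order-preserving maps. -/
structure FinGPoset : Type 1 where
  carrier : Type
  [finite : Finite carrier]
  [order : PartialOrder carrier]
  [action : MulAction C2 carrier]
  smul_mono : ∀ (g : C2) {x y : carrier}, x ≤ y → g • x ≤ g • y

attribute [instance] FinGPoset.finite FinGPoset.order FinGPoset.action

namespace FinGPoset

/-- Isovariant order-preserving maps: order preserving, equivariant, and strictly preserving the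
isotropy groups. -/
@[ext]
structure Hom (A B : FinGPoset) : Type where
  toFun : A.carrier → B.carrier
  monotone : ∀ {x y : A.carrier}, x ≤ y → toFun x ≤ toFun y
  equivariant : ∀ (g : C2) (x : A.carrier), toFun (g • x) = g • toFun x
  isotropy : ∀ x : A.carrier, MulAction.stabilizer C2 x = MulAction.stabilizer C2 (toFun x)

instance : Category FinGPoset where
  Hom := Hom
  id A := ⟨fun x => x, fun h => h, fun _ _ => rfl, fun _ => rfl⟩
  comp f g := ⟨fun x => g.toFun (f.toFun x), fun h => g.monotone (f.monotone h),
    fun a x => by rw [f.equivariant, g.equivariant],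
    fun x => (f.isotropy x).trans (g.isotropy _)⟩

/-- The product `A × {0 < 1}` with the componentwise order, where `G` acts on the first factor
only. -/
structure Thick (A : FinGPoset) : Type where
  pt : A.carrier
  level : Fin 2

namespace Thick

variable {A : FinGPoset}

theorem ext' {x y : Thick A} (h₁ : x.pt = y.pt) (h₂ : x.level = y.level) : x = y := by
  cases x; cases y; cases h₁; cases h₂; rfl

instance : Finite (Thick A) :=
  Finite.of_injective (fun x : Thick A => (x.pt, x.level))
    (fun _ _ h => ext' (congrArg Prod.fst h) (congrArg Prod.snd h))

instance : PartialOrder (Thick A) where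
  le x y := x.pt ≤ y.pt ∧ x.level ≤ y.level
  le_refl _ := ⟨le_rfl, le_rfl⟩
  le_trans _ _ _ h h' := ⟨h.1.trans h'.1, h.2.trans h'.2⟩
  le_antisymm _ _ h h' := ext' (le_antisymm h.1 h'.1) (le_antisymm h.2 h'.2)

instance : MulAction C2 (Thick A) where
  smul g x := ⟨g • x.pt, x.level⟩
  one_smul x := ext' (one_smul C2 x.pt) rfl
  mul_smul g h x := ext' (mul_smul g h x.pt) rfl

theorem stabilizer_eq (x : Thick A) :
    MulAction.stabilizer C2 x = MulAction.stabilizer C2 x.pt := by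
  ext g
  simp only [MulAction.mem_stabilizer_iff]
  exact ⟨fun h => congrArg Thick.pt h, fun h => ext' h rfl⟩

end Thick

/-- The thickening `A × {0 < 1}` of a finite `G`-poset. -/
abbrev thick (A : FinGPoset) : FinGPoset where
  carrier := Thick A
  smul_mono g {x y} (h : x.pt ≤ y.pt ∧ x.level ≤ y.level) :=
    show (g • x.pt ≤ g • y.pt) ∧ x.level ≤ y.level from ⟨A.smul_mono g h.1, h.2⟩

/-- The map `(x, δ) ↦ (f x, δ)` between thickenings. -/
def thickMap {A B : FinGPoset} (f : Hom A B) : Hom (thick A) (thick B) where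
  toFun x := ⟨f.toFun x.pt, x.level⟩
  monotone h := ⟨f.monotone h.1, h.2⟩
  equivariant g x := Thick.ext' (f.equivariant g x.pt) rfl
  isotropy x := by
    rw [Thick.stabilizer_eq x, f.isotropy x.pt]
    exact (Thick.stabilizer_eq (A := B) ⟨f.toFun x.pt, x.level⟩).symm

/-- Thickening as a functor. -/
def thickFunctor : FinGPoset ⥤ FinGPoset where
  obj := thick
  map f := thickMap f

/-- The end inclusion `x ↦ (x, ε)`. -/
def thickEndHom (A : FinGPoset) (ε : Fin 2) : Hom A (thick A) where
  toFun x := ⟨x, ε⟩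
  monotone h := ⟨h, le_rfl⟩
  equivariant _ _ := rfl
  isotropy x := (Thick.stabilizer_eq (A := A) ⟨x, ε⟩).symm

/-- The projection `(x, ε) ↦ x`. -/
def thickProjHom (A : FinGPoset) : Hom (thick A) A where
  toFun x := x.pt
  monotone h := h.1
  equivariant _ _ := rfl
  isotropy x := Thick.stabilizer_eq x

/-- The end inclusions as a natural transformation. -/
def thickEnd (ε : Fin 2) : 𝟭 FinGPoset ⟶ thickFunctor where
  app A := thickEndHom A ε
  naturality _ _ _ := rfl

/-- The projections as a natural transformation. -/
def thickProj : thickFunctor ⟶ 𝟭 FinGPoset where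
  app A := thickProjHom A
  naturality _ _ _ := rfl

theorem thickEnd_thickProj (ε : Fin 2) : thickEnd ε ≫ thickProj = 𝟙 (𝟭 FinGPoset) := rfl

end FinGPoset

/-- The relation `∼ₖ` on `[n] × G`: it identifies `(i, g)` with `(i, h)` when `k ≤ i`. -/
def vertexSetoid (n k : ℕ) : Setoid (Fin (n + 1) × C2) where
  r x y := x.1 = y.1 ∧ (x.2 = y.2 ∨ k ≤ (x.1 : ℕ))
  iseqv :=
    { refl := fun _ => ⟨rfl, Or.inl rfl⟩
      symm := fun {_ _} h => ⟨h.1.symm, h.2.imp Eq.symm (fun hk => h.1 ▸ hk)⟩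
      trans := fun {_ _ _} h h' => ⟨h.1.trans h'.1, by
        rcases h.2 with h₂ | h₂
        · rcases h'.2 with h₃ | h₃
          · exact Or.inl (h₂.trans h₃)
          · exact Or.inr (h.1 ▸ h₃)
        · exact Or.inr h₂⟩ }

/-- The underlying set of `[n]ₖ`, namely `([n] × G) / ∼ₖ`. The vertices `[i, g]` with `k ≤ i` are
real, the others are non-real. -/
def Vertex (n k : ℕ) : Type := Quotient (vertexSetoid n k)

namespace Vertex

variable {n k : ℕ}

/-- The vertex `[i, g]`. -/
def mk (i : Fin (n + 1)) (g : C2) : Vertex n k := Quotient.mk (vertexSetoid n k) (i, g)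

theorem mk_eq_mk {i j : Fin (n + 1)} {g h : C2} :
    (mk i g : Vertex n k) = mk j h ↔ i = j ∧ (g = h ∨ k ≤ (i : ℕ)) :=
  Quotient.eq (r := vertexSetoid n k)

theorem ind {p : Vertex n k → Prop} (h : ∀ i g, p (mk i g)) (x : Vertex n k) : p x :=
  Quotient.ind (fun a => h a.1 a.2) x

instance : Finite (Vertex n k) := Quotient.finite _

/-- The order induced by the product order on `[n] × G` (`G` carrying the trivial order):
`[i, g] ≤ [j, h]` if there are comparable representatives. -/
instance : LE (Vertex n k) where
  le x y := ∃ (i j : Fin (n + 1)) (g : C2), mk i g = x ∧ mk j g = y ∧ i ≤ j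

theorem mk_le_mk {i j : Fin (n + 1)} {g h : C2} :
    (mk i g : Vertex n k) ≤ mk j h ↔ i ≤ j ∧ (g = h ∨ k ≤ (j : ℕ)) := by
  constructor
  · rintro ⟨i', j', g', h₁, h₂, h₃⟩
    obtain ⟨rfl, h₄⟩ := mk_eq_mk.1 h₁
    obtain ⟨rfl, h₅⟩ := mk_eq_mk.1 h₂
    refine ⟨h₃, ?_⟩
    rcases h₄ with h₁ | h₁
    · exact h₁ ▸ h₅
    · exact Or.inr (h₁.trans h₃)
  · rintro ⟨h₁, h₂⟩
    refine ⟨i, j, g, rfl, ?_, h₁⟩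
    exact mk_eq_mk.2 ⟨rfl, h₂⟩

instance : PartialOrder (Vertex n k) where
  le_refl := ind fun _ _ => mk_le_mk.2 ⟨le_rfl, Or.inl rfl⟩
  le_trans := ind fun i g => ind fun j h => ind fun l m hij hjl => by
    rw [mk_le_mk] at *
    refine ⟨hij.1.trans hjl.1, ?_⟩
    rcases hjl.2 with rfl | h₂
    · exact hij.2.imp id (fun h₁ => h₁.trans hjl.1)
    · exact Or.inr h₂
  le_antisymm := ind fun i g => ind fun j h hij hji => by
    rw [mk_le_mk] at *
    have e : i = j := le_antisymm hij.1 hji.1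
    subst e
    exact mk_eq_mk.2 ⟨rfl, hij.2⟩

/-- The action `g • [i, h] = [i, g h]`. -/
instance : MulAction C2 (Vertex n k) where
  smul g := Quotient.map (fun x => (x.1, g * x.2))
    (fun _ _ h => ⟨h.1, h.2.imp (fun e => by rw [e]) id⟩)
  one_smul := ind fun i g => congrArg (mk i) (one_mul g)
  mul_smul a b := ind fun i g => congrArg (mk i) (mul_assoc a b g)

theorem smul_mk (a : C2) (i : Fin (n + 1)) (g : C2) :
    a • (mk i g : Vertex n k) = mk i (a * g) := rfl

theorem mem_stabilizer_mk {a : C2} {i : Fin (n + 1)} {g : C2} :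
    a ∈ MulAction.stabilizer C2 (mk i g : Vertex n k) ↔ a = 1 ∨ k ≤ (i : ℕ) := by
  rw [MulAction.mem_stabilizer_iff, smul_mk, mk_eq_mk]
  simp

end Vertex

/-- The objects `[n]ₖ`, `0 ≤ k ≤ n + 1`, of the isovariant simplex category. -/
structure GDelta : Type where
  n : ℕ
  k : ℕ
  hk : k ≤ n + 1

namespace GDelta

/-- `[n]ₖ` as a finite `G`-poset. -/
def toFinGPoset (a : GDelta) : FinGPoset where
  carrier := Vertex a.n a.k
  smul_mono g x y := by
    revert x y
    refine Vertex.ind fun i h => Vertex.ind fun j h' hle => ?_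
    rw [Vertex.mk_le_mk] at hle
    rw [Vertex.smul_mk, Vertex.smul_mk, Vertex.mk_le_mk]
    exact ⟨hle.1, hle.2.imp (fun e => by rw [e]) id⟩

/-- The isovariant simplex category: all isovariant order-preserving maps `[n]ₖ → [m]ₗ`. -/
instance : Category GDelta where
  Hom a b := a.toFinGPoset ⟶ b.toFinGPoset
  id a := 𝟙 a.toFinGPoset
  comp f g := FinGPoset.instCategory.comp f g

/-- The full inclusion into finite `G`-posets. -/
def incl : GDelta ⥤ FinGPoset where
  obj := toFinGPoset
  map f := f

/-- The morphism `[j, g] ↦ [f j, g]` induced by an order-preserving map `f : [n] → [m]` such that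
`j` is real if and only if `f j` is. -/
def homOfOrderHom {a b : GDelta} (f : Fin (a.n + 1) →o Fin (b.n + 1))
    (hf : ∀ j : Fin (a.n + 1), a.k ≤ (j : ℕ) ↔ b.k ≤ (f j : ℕ)) : a ⟶ b where
  toFun := Quotient.map (fun x => (f x.1, x.2))
    (fun x _ h => ⟨congrArg f h.1, h.2.imp id (fun hk => (hf x.1).1 hk)⟩)
  monotone {x y} hxy := by
    induction x using Vertex.ind with | h i g
    induction y using Vertex.ind with | h j g'
    obtain ⟨h₁, h₂⟩ := Vertex.mk_le_mk.1 hxy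
    exact Vertex.mk_le_mk.2 ⟨f.monotone h₁, h₂.imp id (hf j).1⟩
  equivariant g := Vertex.ind fun _ _ => rfl
  isotropy := Vertex.ind fun i g => by
    ext a
    exact Vertex.mem_stabilizer_mk.trans
      ((or_congr Iff.rfl (hf i)).trans Vertex.mem_stabilizer_mk.symm)

/-- The real coface map `d₀ⁱ : [m]ₖ → [m+1]ₖ`, omitting the real vertex `i ≥ k`. -/
def d0 (m k : ℕ) (i : Fin (m + 2)) (hi : k ≤ (i : ℕ)) :
    (⟨m, k, by omega⟩ : GDelta) ⟶ ⟨m + 1, k, by omega⟩ :=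
  homOfOrderHom (Fin.succAboveOrderEmb i).toOrderHom (fun (j : Fin (m + 1)) => by
    show k ≤ (j : ℕ) ↔ k ≤ ((i.succAbove j : Fin (m + 2)) : ℕ)
    simp only [Fin.succAbove, Fin.lt_def, Fin.val_castSucc]
    split_ifs <;> (simp; try omega))

/-- The non-real coface map `d₁ⁱ : [m]ₖ₋₁ → [m+1]ₖ`, omitting the non-real vertex `i < k`. -/
def d1 (m k : ℕ) (hk : k ≤ m + 2) (i : Fin (m + 2)) (hi : (i : ℕ) < k) :
    (⟨m, k - 1, by omega⟩ : GDelta) ⟶ ⟨m + 1, k, hk⟩ :=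
  homOfOrderHom (Fin.succAboveOrderEmb i).toOrderHom (fun (j : Fin (m + 1)) => by
    show k - 1 ≤ (j : ℕ) ↔ k ≤ ((i.succAbove j : Fin (m + 2)) : ℕ)
    simp only [Fin.succAbove, Fin.lt_def, Fin.val_castSucc]
    split_ifs <;> (simp; try omega))

/-- The real codegeneracy map `s₀ᵃ : [m+1]ₖ → [m]ₖ`, identifying the real vertices `a`, `a + 1`. -/
def s0 (m k : ℕ) (a : Fin (m + 1)) (ha : k ≤ (a : ℕ)) :
    (⟨m + 1, k, by omega⟩ : GDelta) ⟶ ⟨m, k, by omega⟩ :=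
  homOfOrderHom ⟨Fin.predAbove a, Fin.predAbove_right_monotone a⟩ (fun (j : Fin (m + 2)) => by
    show k ≤ (j : ℕ) ↔ k ≤ ((a.predAbove j : Fin (m + 1)) : ℕ)
    simp only [Fin.predAbove, Fin.lt_def, Fin.val_castSucc]
    split_ifs <;> (simp; try omega))

/-- The non-real codegeneracy map `s₁ᵃ : [m+1]ₖ → [m]ₖ₋₁`, identifying the non-real vertices `a`,
`a + 1`. -/
def s1 (m k : ℕ) (hk : k ≤ m + 2) (a : Fin (m + 1)) (ha : (a : ℕ) + 1 < k) :
    (⟨m + 1, k, hk⟩ : GDelta) ⟶ ⟨m, k - 1, by omega⟩ :=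
  homOfOrderHom ⟨Fin.predAbove a, Fin.predAbove_right_monotone a⟩ (fun (j : Fin (m + 2)) => by
    show k ≤ (j : ℕ) ↔ k - 1 ≤ ((a.predAbove j : Fin (m + 1)) : ℕ)
    simp only [Fin.predAbove, Fin.lt_def, Fin.val_castSucc]
    split_ifs <;> (simp; try omega))

end GDelta

/-! ## Isovariant simplicial sets and admissible horns -/

/-- Isovariant simplicial sets: presheaves of sets on the isovariant simplex category. -/
abbrev SSetIsov : Type 1 := GDeltaᵒᵖ ⥤ Type

/-- The standard simplex `Δⁿᵏ`. -/
abbrev stdSimplex (a : GDelta) : SSetIsov := yoneda.obj a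

/-- Indices `(n, k, l)` of horns `Λₗⁿᵏ`, with `n = m + 1 > 0`, `0 ≤ k ≤ n + 1` and `0 ≤ l ≤ n`. -/
structure HornIndex : Type where
  m : ℕ
  k : ℕ
  hk : k ≤ m + 2
  l : Fin (m + 2)

namespace HornIndex

/-- The object `[n]ₖ`. -/
abbrev top (p : HornIndex) : GDelta := ⟨p.m + 1, p.k, p.hk⟩

/-- The horn `Λₗⁿᵏ ⊆ Δⁿᵏ`: the union of the non-real faces `∂₁ⁱ`, `i < k`, and of the real faces
`∂₀ⁱ`, `k ≤ i`, over `i ≠ l`. -/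
def horn (p : HornIndex) : Subfunctor (stdSimplex p.top) :=
  (⨆ (i : Fin (p.m + 2)) (hi : (i : ℕ) < p.k) (_ : i ≠ p.l),
      Subfunctor.range (yoneda.map (GDelta.d1 p.m p.k p.hk i hi))) ⊔
    (⨆ (i : Fin (p.m + 2)) (hi : p.k ≤ (i : ℕ)) (_ : i ≠ p.l),
      Subfunctor.range (yoneda.map (GDelta.d0 p.m p.k i hi)))

/-- The horn `Λₗⁿᵏ` is admissible if, for some `a ∈ {l - 1, l}` and for `ε = 1` or `ε = 0`, there
are a codegeneracy `s_εᵃ` and a coface `d_εˡ` such that the image of `d_εˡ ∘ s_εᵃ` is the face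
`∂_εˡ`. -/
def IsAdmissible (p : HornIndex) : Prop :=
  ∃ a : Fin (p.m + 1), ((a : ℕ) = (p.l : ℕ) ∨ (a : ℕ) + 1 = (p.l : ℕ)) ∧
    ((∃ (hl : (p.l : ℕ) < p.k) (ha : (a : ℕ) + 1 < p.k),
        Subfunctor.range
            (yoneda.map (GDelta.s1 p.m p.k p.hk a ha ≫ GDelta.d1 p.m p.k p.hk p.l hl)) =
          Subfunctor.range (yoneda.map (GDelta.d1 p.m p.k p.hk p.l hl))) ∨
      (∃ (hl : p.k ≤ (p.l : ℕ)) (ha : p.k ≤ (a : ℕ)),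
        Subfunctor.range
            (yoneda.map (GDelta.s0 p.m p.k a ha ≫ GDelta.d0 p.m p.k p.l hl)) =
          Subfunctor.range (yoneda.map (GDelta.d0 p.m p.k p.l hl))))

end HornIndex

/-- The admissible horn inclusions `Λₗⁿᵏ → Δⁿᵏ`. -/
def admissibleHornInclusions : MorphismProperty SSetIsov :=
  MorphismProperty.ofHoms (fun p : {p : HornIndex // p.IsAdmissible} => p.1.horn.ι)

/-- A class of morphisms is saturated if it is stable under retracts, pushouts and (small)
transfinite compositions. -/
structure IsSaturated {C : Type 1} [Category.{0} C] (W : MorphismProperty C) : Prop where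
  retracts : W.IsStableUnderRetracts
  pushouts : W.IsStableUnderCobaseChange
  transfinite : MorphismProperty.IsStableUnderTransfiniteComposition.{0} W

/-- Isovariant anodyne extensions: the smallest saturated class containing the admissible horn
inclusions. -/
def isovariantAnodyne : MorphismProperty SSetIsov := fun _ _ f =>
  ∀ W : MorphismProperty SSetIsov, IsSaturated W → admissibleHornInclusions ≤ W → W f

/-! ## Normal isovariant simplicial sets -/

section Normal

variable (X : SSetIsov)

/-- A simplex is non-degenerate if it is not the image of a simplex under an epimorphism of the
isovariant simplex category which is not an isomorphism. -/
def IsNondegenerate {a : GDelta} (u : X.obj (op a)) : Prop :=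
  ∀ (b : GDelta) (π : a ⟶ b) (v : X.obj (op b)), Epi π → X.map π.op v = u → IsIso π

/-- A non-degenerate simplex is dominant if it has no nontrivial automorphism over `X`. -/
def IsDominant {a : GDelta} (u : X.obj (op a)) : Prop :=
  IsNondegenerate X u ∧ ∀ φ : a ≅ a, X.map φ.hom.op u = u → φ = Iso.refl a

/-- A simplex is normal if it is the image of a dominant simplex under an epimorphism. -/
def IsNormalSimplex {a : GDelta} (v : X.obj (op a)) : Prop :=
  ∃ (b : GDelta) (π : a ⟶ b) (u : X.obj (op b)), Epi π ∧ IsDominant X u ∧ X.map π.op u = v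

/-- An isovariant simplicial set is normal if all its simplices are. -/
def IsNormal : Prop := ∀ (a : GDelta) (v : X.obj (op a)), IsNormalSimplex X v

end Normal

/-! ## Functorial cylinders and classes of anodyne extensions -/

/-- A functorial cylinder: a functor `I` with natural maps `∂₀, ∂₁ : X → I X` and `ρ : I X → X` such
that `ρ ∘ ∂_ε = id`. -/
structure FunctorialCylinder (C : Type 1) [Category.{0} C] where
  I : C ⥤ C
  δ (ε : Fin 2) : 𝟭 C ⟶ I
  ρ : I ⟶ 𝟭 C
  δ_ρ (ε : Fin 2) : δ ε ≫ ρ = 𝟙 (𝟭 C)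

namespace FunctorialCylinder

section

variable {C : Type 1} [Category.{0} C] [HasColimits C] (T : FunctorialCylinder C)

/-- The canonical map `I K ∪ {ε} L → I L`, where `I K ∪ {ε} L` is the pushout of `I K ← K → L`. -/
noncomputable def endMap (ε : Fin 2) {K L : C} (f : K ⟶ L) :
    pushout ((T.δ ε).app K) f ⟶ T.I.obj L :=
  pushout.desc (T.I.map f) ((T.δ ε).app L) ((T.δ ε).naturality f).symm

/-- The map `(∂₀, ∂₁) : ∂I(X) = X ⨿ X → I X`. -/
noncomputable def bdry (X : C) : X ⨿ X ⟶ T.I.obj X :=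
  coprod.desc ((T.δ 0).app X) ((T.δ 1).app X)

/-- The canonical map `I K ∪ ∂I(L) → I L`, where `I K ∪ ∂I(L)` is the pushout of
`I K ← ∂I(K) → ∂I(L)`. -/
noncomputable def bdryMap {K L : C} (f : K ⟶ L) :
    pushout (T.bdry K) (coprod.map f f) ⟶ T.I.obj L :=
  pushout.desc (T.I.map f) (T.bdry L) (by
    have h₀ : (T.δ 0).app K ≫ T.I.map f = f ≫ (T.δ 0).app L := ((T.δ 0).naturality f).symm
    have h₁ : (T.δ 1).app K ≫ T.I.map f = f ≫ (T.δ 1).app L := ((T.δ 1).naturality f).symm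
    simp only [bdry, coprod.desc_comp, coprod.map_desc, h₀, h₁])

/-- Cisinski's axioms for a class of `I`-anodyne extensions. -/
structure IsAnodyneClass (An : MorphismProperty C) : Prop where
  /-- There is a (small) set `S` of monomorphisms such that `An` is the class of morphisms with the
  left lifting property against all morphisms with the right lifting property against `S`. -/
  an0 : ∃ S : MorphismProperty C, MorphismProperty.IsSmall.{0} S ∧
    S ≤ MorphismProperty.monomorphisms C ∧ An = S.rlp.llp
  /-- For every monomorphism `K → L` and `ε = 0, 1`, the map `I K ∪ {ε} L → I L` is in `An`. -/
  an1 : ∀ (ε : Fin 2) {K L : C} (f : K ⟶ L), Mono f → An (T.endMap ε f)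
  /-- If `K → L` is in `An`, then so is `I K ∪ ∂I(L) → I L`. -/
  an2 : ∀ {K L : C} (f : K ⟶ L), An f → An (T.bdryMap f)

end

/-- The cylinder `I_B` induced on the category over `B`: the structural map of `I_B X = I X` is
`I X → I B → B`. -/
def overCylinder {C : Type 1} [Category.{0} C] (T : FunctorialCylinder C) (B : C) :
    FunctorialCylinder (Over B) where
  I :=
    { obj := fun X => Over.mk (T.I.map X.hom ≫ T.ρ.app B)
      map := fun {X Y} f => Over.homMk (T.I.map f.left) (by
        simp) }
  δ ε :=
    { app := fun X => Over.homMk ((T.δ ε).app X.left) (by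
        have h₁ := (T.δ ε).naturality X.hom
        have h₂ := NatTrans.congr_app (T.δ_ρ ε) B
        simp only [Functor.id_map, Functor.id_obj, NatTrans.comp_app, NatTrans.id_app] at h₁ h₂
        simp only [Over.mk_hom, Functor.id_obj]
        erw [← reassoc_of% h₁, h₂]
        simp)
      naturality := fun X Y f => by
        ext
        exact (T.δ ε).naturality f.left }
  ρ :=
    { app := fun X => Over.homMk (T.ρ.app X.left) (by simp)
      naturality := fun X Y f => by
        ext
        exact T.ρ.naturality f.left }
  δ_ρ ε := by
    ext X
    exact NatTrans.congr_app (T.δ_ρ ε) X.left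

end FunctorialCylinder

/-! ## The cylinder of isovariant simplicial sets -/

/-- The functor sending a finite `G`-poset `A` to the presheaf of isovariant order-preserving maps
`[m]ₗ → A`. -/
def nerve : FinGPoset ⥤ SSetIsov := yoneda ⋙ (Functor.whiskeringLeft _ _ _).obj GDelta.incl.op

/-- The functor `[n]ₖ ↦ Iⁿᵏ`, the presheaf of isovariant order-preserving maps into
`[n]ₖ × {0 < 1}`. -/
def simplexCylinder : GDelta ⥤ SSetIsov := GDelta.incl ⋙ FinGPoset.thickFunctor ⋙ nerve

/-- The maps `∂_εⁿᵏ : Δⁿᵏ → Iⁿᵏ`, `α ↦ (α, ε)`. -/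
def simplexEnd (ε : Fin 2) : (yoneda : GDelta ⥤ SSetIsov) ⟶ simplexCylinder :=
  Functor.whiskerLeft GDelta.incl (Functor.whiskerRight (FinGPoset.thickEnd ε) nerve)

/-- The maps `ρⁿᵏ : Iⁿᵏ → Δⁿᵏ`, `α ↦ pr ∘ α`. -/
def simplexProj : simplexCylinder ⟶ (yoneda : GDelta ⥤ SSetIsov) :=
  Functor.whiskerLeft GDelta.incl (Functor.whiskerRight FinGPoset.thickProj nerve)

/-- The cylinder functor of isovariant simplicial sets, the left Kan extension of `[n]ₖ ↦ Iⁿᵏ` along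
the Yoneda embedding. -/
noncomputable def cylinderFunctor : SSetIsov ⥤ SSetIsov :=
  (yoneda : GDelta ⥤ SSetIsov).leftKanExtension simplexCylinder

/-- The universal natural transformation `Iⁿᵏ → I(Δⁿᵏ)`. -/
noncomputable def cylinderUnit : simplexCylinder ⟶ yoneda ⋙ cylinderFunctor :=
  (yoneda : GDelta ⥤ SSetIsov).leftKanExtensionUnit simplexCylinder

instance : cylinderFunctor.IsLeftKanExtension cylinderUnit :=
  inferInstanceAs (((yoneda : GDelta ⥤ SSetIsov).leftKanExtension simplexCylinder).IsLeftKanExtension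
    ((yoneda : GDelta ⥤ SSetIsov).leftKanExtensionUnit simplexCylinder))

/-- The functorial cylinder of isovariant simplicial sets. The maps `∂_ε : X → I X` and
`ρ : I X → X` are those induced by `∂_εⁿᵏ` and `ρⁿᵏ`; for `∂_ε` one uses that the identity functor
is the left Kan extension of the Yoneda embedding along itself. -/
noncomputable def cylinder : FunctorialCylinder SSetIsov where
  I := cylinderFunctor
  δ ε := (𝟭 SSetIsov).descOfIsLeftKanExtension (Functor.rightUnitor (yoneda : GDelta ⥤ SSetIsov)).inv
    cylinderFunctor (simplexEnd ε ≫ cylinderUnit)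
  ρ := cylinderFunctor.descOfIsLeftKanExtension cylinderUnit (𝟭 SSetIsov)
    (simplexProj ≫ (Functor.rightUnitor (yoneda : GDelta ⥤ SSetIsov)).inv)
  δ_ρ ε := by
    apply Functor.hom_ext_of_isLeftKanExtension _
      (Functor.rightUnitor (yoneda : GDelta ⥤ SSetIsov)).inv
    rw [Functor.whiskerLeft_comp, Functor.descOfIsLeftKanExtension_fac_assoc, Category.assoc,
      Functor.descOfIsLeftKanExtension_fac]
    rfl

/-- The class `An_B` of maps over `B` whose underlying map is an isovariant anodyne extension. -/
def fiberwiseAnodyne (B : SSetIsov) : MorphismProperty (Over B) :=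
  isovariantAnodyne.inverseImage (Over.forget B)

end Isov

/-! An isovariant map into `[n]ₖ × {0 < 1}` is an isovariant map into `[n]ₖ` together with an
order-preserving, `G`-invariant level function on its source. Levels form a presheaf `interval`, the
cylinder of a representable is its product with `interval`, and since this product preserves
colimits, `IX` is `interval ⊗ X` for every `X` (`cylinderIso`). For a monomorphism `K → L` the
canonical maps of An1 and An2 then become inclusions `A ⊗ L ∪ interval ⊗ K → interval ⊗ L`, with `A`
one end or both ends of the interval.

By the small object argument, anodyne extensions are the left class of a lifting condition
(`isovariantAnodyne_eq`). The exponential adjunction then reduces every statement about such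
inclusions to generators (`unionProd_mem_llp`).

For An1, normality makes the action on simplices free (`IsNormal.isFree`), and freeness passes to
everything over `B`. A subobject of a free object is completed by attaching simplices of least
missing dimension along their boundaries (`cell_of_minimal`), so boundaries generate. Over a
boundary, the prism is filled by the usual `n + 1` top simplices; each doubles one index, both
copies are real or both non-real, and this makes the attaching horn admissible (`anodyneLLP_prism`).

For An2 the generators are admissible horns. The omitted index `l` has a neighbour `q` of the same
type, and collapsing `q` to `l` deforms the simplex into its horn. The deformation exhibits the
inclusion of An2 as a retract of an inclusion of the kind in An1 over `interval ⊗ Δ`, which is free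
(`anodyneLLP_unionProd_bdry_horn_of_deformation`). Hence normality plays no role in An2. Finally,
An0 over `B` is a retract argument (`overFamily_rlp_llp`). -/

open scoped MonoidalCategory

/-! ### Vertices, and morphisms as order maps up to a twist by `G` -/

namespace Isov

namespace Vertex

variable {n k : ℕ}

/-- The index `i` of the vertex `[i, g]`. -/
def idx : Vertex n k → Fin (n + 1) :=
  Quotient.lift (fun x => x.1) (fun _ _ h => h.1)

@[simp]
theorem idx_smul (g : C2) (x : Vertex n k) : idx (g • x) = idx x := by
  induction x using Vertex.ind with | h i h => rfl

theorem exists_eq_mk (x : Vertex n k) : ∃ g, x = mk x.idx g := by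
  induction x using Vertex.ind with | h i g => exact ⟨g, rfl⟩

theorem idx_mono {x y : Vertex n k} (h : x ≤ y) : x.idx ≤ y.idx := by
  induction x using Vertex.ind with | h i g =>
  induction y using Vertex.ind with | h j g' => exact (mk_le_mk.1 h).1

theorem eq_smul_mk_one (x : Vertex n k) : ∃ g : C2, x = g • mk x.idx 1 := by
  obtain ⟨g, hg⟩ := x.exists_eq_mk
  exact ⟨g, by rw [smul_mk, mul_one]; exact hg⟩

/-- Being real is a condition on isotropy alone; this is why isovariant maps preserve and reflect it
(`shape_real`). -/
theorem real_iff {x : Vertex n k} :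
    k ≤ (x.idx : ℕ) ↔ MulAction.stabilizer C2 x = ⊤ := by
  obtain ⟨g, hg⟩ := x.exists_eq_mk
  generalize x.idx = i at hg
  subst hg
  constructor
  · intro h
    ext a
    simp only [mem_stabilizer_mk, Subgroup.mem_top, iff_true]
    exact Or.inr h
  · intro h
    have h' : Multiplicative.ofAdd (1 : ZMod 2) ∈ MulAction.stabilizer C2 (mk i g : Vertex n k) := by
      rw [h]; trivial
    rcases mem_stabilizer_mk.1 h' with h'' | h''
    · exact absurd h'' (by decide)
    · exact h''

end Vertex

namespace GDelta

variable {a b c : GDelta}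

/-- The vertices of `[n]ₖ` as the carrier of the associated `G`-poset. -/
abbrev vertex (a : GDelta) (i : Fin (a.n + 1)) (g : C2) : a.toFinGPoset.carrier :=
  (Vertex.mk i g : Vertex a.n a.k)

/-- A morphism of the isovariant simplex category as an isovariant map. -/
abbrev asHom (f : a ⟶ b) : FinGPoset.Hom a.toFinGPoset b.toFinGPoset := f

/-- The index of a vertex. -/
abbrev index (x : a.toFinGPoset.carrier) : Fin (a.n + 1) := Vertex.idx (n := a.n) (k := a.k) x

theorem hom_ext {f g : a ⟶ b}
    (h : ∀ i, (asHom f).toFun (a.vertex i 1) = (asHom g).toFun (a.vertex i 1)) : f = g := by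
  apply FinGPoset.Hom.ext
  funext x
  obtain ⟨u, hu⟩ := Vertex.eq_smul_mk_one (n := a.n) (k := a.k) x
  have hx : x = u • a.vertex (index x) 1 := hu
  rw [hx]
  exact ((asHom f).equivariant u _).trans
    ((congrArg (u • ·) (h _)).trans ((asHom g).equivariant u _).symm)

/-- The map on indices underlying a morphism `[n]ₖ → [m]ₗ`. -/
def shape (f : a ⟶ b) : Fin (a.n + 1) →o Fin (b.n + 1) where
  toFun i := index ((asHom f).toFun (a.vertex i 1))
  monotone' _ _ h := Vertex.idx_mono ((asHom f).monotone (Vertex.mk_le_mk.2 ⟨h, Or.inl rfl⟩))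

theorem index_toFun (f : a ⟶ b) (x : a.toFinGPoset.carrier) :
    index ((asHom f).toFun x) = shape f (index x) := by
  obtain ⟨u, hu⟩ := Vertex.eq_smul_mk_one (n := a.n) (k := a.k) x
  have hx : x = u • a.vertex (index x) 1 := hu
  conv_lhs => rw [hx, (asHom f).equivariant]
  exact Vertex.idx_smul _ _

@[simp]
theorem shape_comp (f : a ⟶ b) (g : b ⟶ c) (i : Fin (a.n + 1)) :
    shape (f ≫ g) i = shape g (shape f i) :=
  index_toFun g _

@[simp]
theorem shape_id (i : Fin (a.n + 1)) : shape (𝟙 a) i = i := rfl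

theorem shape_real (f : a ⟶ b) (j : Fin (a.n + 1)) :
    a.k ≤ (j : ℕ) ↔ b.k ≤ (shape f j : ℕ) := by
  have h₁ := Vertex.real_iff (x := (Vertex.mk j 1 : Vertex a.n a.k))
  have h₂ := Vertex.real_iff (n := b.n) (k := b.k) (x := (asHom f).toFun (a.vertex j 1))
  refine h₁.trans (Iff.trans ?_ h₂.symm)
  exact Eq.congr_left ((asHom f).isotropy (a.vertex j 1))

/-- The action of `g ∈ G` on `[n]ₖ`, as a morphism. -/
def twist (a : GDelta) (g : C2) : a ⟶ a :=
  show FinGPoset.Hom a.toFinGPoset a.toFinGPoset from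
  { toFun := fun x => g • x
    monotone := fun h => a.toFinGPoset.smul_mono g h
    equivariant := fun h x => by rw [← mul_smul, ← mul_smul, mul_comm]
    isotropy := fun x => by
      ext u
      simp only [MulAction.mem_stabilizer_iff]
      rw [← mul_smul, mul_comm, mul_smul]
      exact (smul_left_cancel_iff g).symm }

@[simp]
theorem shape_twist (g : C2) (i : Fin (a.n + 1)) : shape (a.twist g) i = i := rfl

theorem twist_comp (g : C2) (f : a ⟶ b) : a.twist g ≫ f = f ≫ b.twist g :=
  FinGPoset.Hom.ext (funext fun x => (asHom f).equivariant g x)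

theorem twist_one : a.twist 1 = 𝟙 a :=
  FinGPoset.Hom.ext (funext fun x => one_smul C2 x)

theorem twist_mul (g h : C2) : a.twist g ≫ a.twist h = a.twist (h * g) :=
  FinGPoset.Hom.ext (funext fun x => (mul_smul h g x).symm)

theorem homOfOrderHom_comp (φ : Fin (a.n + 1) →o Fin (b.n + 1))
    (hφ : ∀ j : Fin (a.n + 1), a.k ≤ (j : ℕ) ↔ b.k ≤ (φ j : ℕ))
    (ψ : Fin (b.n + 1) →o Fin (c.n + 1))
    (hψ : ∀ j : Fin (b.n + 1), b.k ≤ (j : ℕ) ↔ c.k ≤ (ψ j : ℕ)) :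
    homOfOrderHom φ hφ ≫ homOfOrderHom ψ hψ =
      homOfOrderHom (ψ.comp φ) (fun j => (hφ j).trans (hψ _)) :=
  hom_ext fun _ => rfl

theorem twist_eq_id (h : a.k = 0) (g : C2) : a.twist g = 𝟙 a :=
  hom_ext fun i => Vertex.mk_eq_mk.2 ⟨rfl, Or.inr (by omega)⟩

theorem eq_one_of_twist_eq_id (h : a.k ≠ 0) {g : C2} (hg : a.twist g = 𝟙 a) : g = 1 := by
  have h₁ : (asHom (a.twist g)).toFun (a.vertex 0 1) = a.vertex 0 1 := by rw [hg]; rfl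
  obtain ⟨-, h₂⟩ := Vertex.mk_eq_mk.1 h₁
  rcases h₂ with h₂ | h₂
  · simpa using h₂
  · simp at h₂; exact absurd h₂ h

/-- Every morphism is a twist followed by the morphism given by its underlying map of indices. -/
theorem exists_eq_twist_comp (f : a ⟶ b) :
    ∃ g : C2, f = a.twist g ≫ homOfOrderHom (shape f) (shape_real f) := by
  -- The group element is read off at the vertex `[0, 1]`, which lies below every `[i, 1]`:
  -- comparable vertices carry the same group element unless the upper one is real, where the
  -- element does not matter.
  obtain ⟨g, hg⟩ := Vertex.exists_eq_mk (n := b.n) (k := b.k) ((asHom f).toFun (a.vertex 0 1))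
  refine ⟨g, hom_ext fun i => ?_⟩
  obtain ⟨g', hg'⟩ := Vertex.exists_eq_mk (n := b.n) (k := b.k) ((asHom f).toFun (a.vertex i 1))
  refine hg'.trans (Vertex.mk_eq_mk.2 ⟨rfl, ?_⟩)
  have hle : (Vertex.mk (shape f 0) g : Vertex b.n b.k) ≤ Vertex.mk (shape f i) g' :=
    le_of_eq_of_le hg.symm (le_of_le_of_eq
      ((asHom f).monotone (Vertex.mk_le_mk.2 ⟨Fin.zero_le i, Or.inl rfl⟩)) hg')
  rcases (Vertex.mk_le_mk.1 hle).2 with h | h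
  · exact Or.inl (h ▸ (mul_one g).symm)
  · exact Or.inr h

/-- Morphisms lift along maps of indices. -/
theorem exists_lift (f : a ⟶ c) (ψ : Fin (b.n + 1) →o Fin (c.n + 1))
    (hψ : ∀ j : Fin (b.n + 1), b.k ≤ (j : ℕ) ↔ c.k ≤ (ψ j : ℕ))
    (χ : Fin (a.n + 1) →o Fin (b.n + 1)) (h : ∀ i, ψ (χ i) = shape f i) :
    ∃ f' : a ⟶ b, shape f' = χ ∧ f' ≫ homOfOrderHom ψ hψ = f := by
  obtain ⟨g, hg⟩ := exists_eq_twist_comp f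
  have hχ : ∀ j : Fin (a.n + 1), a.k ≤ (j : ℕ) ↔ b.k ≤ (χ j : ℕ) := fun j => by
    rw [hψ, h, ← shape_real]
  refine ⟨a.twist g ≫ homOfOrderHom χ hχ, ?_, ?_⟩
  · ext i
    rw [shape_comp, shape_twist]
    rfl
  · rw [Category.assoc, homOfOrderHom_comp]
    conv_rhs => rw [hg]
    congr 1
    exact hom_ext fun i => by
      show Vertex.mk _ _ = Vertex.mk _ _
      exact congrArg (fun j => Vertex.mk j 1) (h i)

/-- Two morphisms with the same map of indices agree if they become equal after a composition. -/
theorem eq_of_comp_eq {f g : a ⟶ b} (p : b ⟶ c) (hs : shape f = shape g) (h : f ≫ p = g ≫ p) :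
    f = g := by
  refine hom_ext fun i => ?_
  obtain ⟨u, hu⟩ := Vertex.exists_eq_mk (n := b.n) (k := b.k) ((asHom f).toFun (a.vertex i 1))
  obtain ⟨v, hv⟩ := Vertex.exists_eq_mk (n := b.n) (k := b.k) ((asHom g).toFun (a.vertex i 1))
  obtain ⟨t, ht⟩ := exists_eq_twist_comp p
  have h₁ : (asHom p).toFun (b.vertex (shape f i) u) = (asHom p).toFun (b.vertex (shape g i) v) :=
    (congrArg (asHom p).toFun hu.symm).trans
      ((congrArg (fun q => (asHom q).toFun (a.vertex i 1)) h).trans (congrArg (asHom p).toFun hv))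
  rw [ht] at h₁
  obtain ⟨-, h₂⟩ := Vertex.mk_eq_mk.1 h₁
  refine hu.trans (Eq.trans (Vertex.mk_eq_mk.2 ⟨congrArg (fun s => s i) hs, ?_⟩) hv.symm)
  rcases h₂ with h₂ | h₂
  · exact Or.inl (mul_left_cancel h₂)
  · exact Or.inr ((shape_real p _).2 h₂)

end GDelta
end Isov

/-! ### Subfunctors: cell attachment, unions, saturated classes -/

namespace Isov

section Presheaf

variable {C : Type} [Category.{0} C]

/-- An elementwise criterion for a square of presheaves to be a pushout. -/
theorem isPushout_of_elementwise {K M D P : C ⥤ Type} {t : K ⟶ M} {l : K ⟶ D} {r : M ⟶ P}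
    {b : D ⟶ P} (w : t ≫ r = l ≫ b) (hr : ∀ a, Function.Injective (r.app a))
    (htl : ∀ a (x y : K.obj a), t.app a x = t.app a y → l.app a x = l.app a y → x = y)
    (hs : ∀ a (x : P.obj a), x ∈ Set.range (r.app a) ∨ x ∈ Set.range (b.app a))
    (hp : ∀ a (x : M.obj a) (y : D.obj a), r.app a x = b.app a y → y ∈ Set.range (l.app a))
    (hb : ∀ a (x y : D.obj a), x ∉ Set.range (l.app a) → y ∉ Set.range (l.app a) →
      b.app a x = b.app a y → x = y) :
    IsPushout t l r b where
  w := w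
  isColimit' := ⟨evaluationJointlyReflectsColimits _ (fun a => by
    refine (isColimitMapCoconePushoutCoconeEquiv _ _).2 (IsPushout.isColimit ?_)
    have w' : t.app a ≫ r.app a = l.app a ≫ b.app a := congr_app w a
    have w'' : ∀ z, r.app a (t.app a z) = b.app a (l.app a z) := fun z =>
      ConcreteCategory.congr_hom w' z
    have : Mono (((evaluation C Type).obj a).map r) := (mono_iff_injective _).2 (hr a)
    refine Types.isPushout_of_isPullback_of_mono' ?_ ?_ (hb a)
    · refine (Types.isPullback_iff _ _ _ _).2 ⟨w', fun x y h => htl a x y h.1 h.2, fun x y h => ?_⟩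
      obtain ⟨z, rfl⟩ := hp a x y h
      exact ⟨z, hr a ((w'' z).trans h.symm), rfl⟩
    · ext x
      simpa using hs a x)⟩

/-- Attaching a cell `x : D ⟶ Z` to a subfunctor `A` of `Z`. -/
theorem isPushout_attach {Z D : C ⥤ Type} (A : Subfunctor Z) (x : D ⟶ Z)
    (hx : ∀ a (y y' : D.obj a), x.app a y ∉ A.obj a → x.app a y = x.app a y' → y = y') :
    IsPushout (A.fromPreimage x) (A.preimage x).ι
      (Subfunctor.homOfLe (le_sup_left : A ≤ A ⊔ Subfunctor.range x))
      (Subfunctor.lift x (le_sup_right : Subfunctor.range x ≤ A ⊔ Subfunctor.range x)) := by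
  refine isPushout_of_elementwise rfl ?_ ?_ ?_ ?_ ?_
  · intro a y y' h
    exact Subtype.ext (congrArg Subtype.val h :)
  · intro a y y' _ h
    exact Subtype.ext h
  · rintro a ⟨y, hy | ⟨z, rfl⟩⟩
    · exact Or.inl ⟨⟨y, hy⟩, rfl⟩
    · exact Or.inr ⟨z, rfl⟩
  · intro a y z h
    refine ⟨⟨z, ?_⟩, rfl⟩
    have h' : y.1 = x.app a z := congrArg Subtype.val h
    show x.app a z ∈ A.obj a
    rw [← h']
    exact y.2
  · intro a y y' hy _ h
    refine hx a y y' (fun hA => hy ⟨⟨y, hA⟩, rfl⟩) (congrArg Subtype.val h)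

/-- Enlarging `A` by a cell is a cobase change of the part of the cell already in `A`. Simplices of
the cell may be identified inside `A`, so injectivity is asked only outside it. -/
theorem homOfLe_mem_of_attach {W : MorphismProperty (C ⥤ Type)} [W.IsStableUnderCobaseChange]
    {Z D : C ⥤ Type} {A B : Subfunctor Z} (hAB : A ≤ B) (x : D ⟶ Z)
    (hB : B = A ⊔ Subfunctor.range x)
    (hx : ∀ a (y y' : D.obj a), x.app a y ∉ A.obj a → x.app a y = x.app a y' → y = y')
    (hW : W (A.preimage x).ι) : W (Subfunctor.homOfLe hAB) := by
  subst hB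
  exact W.of_isPushout (isPushout_attach A x hx) hW

/-- The functor of subfunctors. -/
def subfunctorToFunctor (Z : C ⥤ Type) : Subfunctor Z ⥤ (C ⥤ Type) where
  obj A := A.toFunctor
  map h := Subfunctor.homOfLe (leOfHom h)

/-- A monotone family of subfunctors over a directed order with union `B` has colimit `B`. -/
noncomputable def isColimitOfIUnion {Z : C ⥤ Type} {J : Type} [LinearOrder J] {F : J → Subfunctor Z}
    (hF : Monotone F) (B : Subfunctor Z) (hB : ∀ j, F j ≤ B)
    (hB' : ∀ a (x : Z.obj a), x ∈ B.obj a → ∃ j, x ∈ (F j).obj a) :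
    IsColimit (Cocone.mk (F := hF.functor ⋙ subfunctorToFunctor Z) B.toFunctor
      { app := fun j => Subfunctor.homOfLe (hB j) }) :=
  evaluationJointlyReflectsColimits _ (fun a => by
    apply Nonempty.some
    exact ⟨Types.FilteredColimit.isColimitOf _ _
      (fun x => by
        obtain ⟨j, hj⟩ := hB' a x.1 x.2
        exact ⟨j, ⟨x.1, hj⟩, rfl⟩)
      (fun i j x y h => by
        have h' : x.1 = y.1 := congrArg Subtype.val h
        rcases le_total i j with hij | hij
        · exact ⟨j, homOfLE hij, 𝟙 _, Subtype.ext h'⟩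
        · exact ⟨i, 𝟙 _, homOfLE hij, Subtype.ext h'⟩)⟩)

theorem isSaturated_monomorphisms :
    IsSaturated (MorphismProperty.monomorphisms (C ⥤ Type)) where
  retracts := inferInstance
  pushouts := by
    rw [← MorphismProperty.functorCategory_monomorphisms]
    infer_instance
  transfinite :=
    { isStableUnderTransfiniteCompositionOfShape := fun J _ _ _ _ => by infer_instance }

theorem IsSaturated.inf {D : Type 1} [Category.{0} D] {W W' : MorphismProperty D}
    (h : IsSaturated W) (h' : IsSaturated W') : IsSaturated (W ⊓ W') where
  retracts := by
    have := h.retracts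
    have := h'.retracts
    infer_instance
  pushouts := by
    have := h.pushouts
    have := h'.pushouts
    exact MorphismProperty.IsStableUnderCobaseChange.inf
  transfinite :=
    { isStableUnderTransfiniteCompositionOfShape := fun J _ _ _ _ => by
        have := h.transfinite
        have := h'.transfinite
        exact ⟨le_inf
          ((MorphismProperty.transfiniteCompositionsOfShape_monotone J inf_le_left).trans
            (W.transfiniteCompositionsOfShape_le J))
          ((MorphismProperty.transfiniteCompositionsOfShape_monotone J inf_le_right).trans
            (W'.transfiniteCompositionsOfShape_le J))⟩ }

theorem isSaturated_llp {D : Type 1} [Category.{0} D] (T : MorphismProperty D) :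
    IsSaturated T.llp where
  retracts := inferInstance
  pushouts := inferInstance
  transfinite := inferInstance

end Presheaf
end Isov

/-! ### Transfinite unions and coproducts in saturated classes -/

namespace Isov

section Saturated

variable {C : Type} [Category.{0} C]

theorem sigma_ι_jointly_surjective {T : Type} (X : T → C ⥤ Type) (a : C)
    (z : (∐ X).obj a) : ∃ (j : T) (y : (X j).obj a), (Sigma.ι X j).app a y = z := by
  have h := isColimitCofanMkObjOfIsColimit ((evaluation _ _).obj a) _ _ (coproductIsCoproduct X)
  obtain ⟨j, y, hy⟩ := Cofan.inj_jointly_surjective_of_isColimit h z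
  exact ⟨j, y, hy⟩

theorem sigma_ι_eq {T : Type} (X : T → C ⥤ Type) (a : C) {j j' : T}
    {y : (X j).obj a} {y' : (X j').obj a} (h : (Sigma.ι X j).app a y = (Sigma.ι X j').app a y') :
    j = j' := by
  have h' := isColimitCofanMkObjOfIsColimit ((evaluation _ _).obj a) _ _ (coproductIsCoproduct X)
  exact Cofan.eq_of_inj_apply_eq_of_isColimit h' _ _ h

theorem sigma_ι_injective {T : Type} (X : T → C ⥤ Type) (a : C) {j : T}
    {y y' : (X j).obj a} (h : (Sigma.ι X j).app a y = (Sigma.ι X j).app a y') :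
    y = y' := by
  have h' := isColimitCofanMkObjOfIsColimit ((evaluation _ _).obj a) _ _ (coproductIsCoproduct X)
  exact Cofan.inj_injective_of_isColimit h' j h

variable {W : MorphismProperty (C ⥤ Type)}

/-- A transfinite composition along an increasing family of subfunctors. -/
theorem homOfLe_mem_of_transfinite [MorphismProperty.IsStableUnderTransfiniteComposition.{0} W]
    {Z : C ⥤ Type} {J : Type} [LinearOrder J] [SuccOrder J] [OrderBot J] [WellFoundedLT J]
    {F : J → Subfunctor Z} (hF : Monotone F)
    (hlim : ∀ j, Order.IsSuccLimit j → ∀ a (x : Z.obj a), x ∈ (F j).obj a →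
      ∃ i < j, x ∈ (F i).obj a)
    (hsucc : ∀ j, ¬ IsMax j → W (Subfunctor.homOfLe (hF (Order.le_succ j))))
    (B : Subfunctor Z) (hB : ∀ j, F j ≤ B)
    (hB' : ∀ a (x : Z.obj a), x ∈ B.obj a → ∃ j, x ∈ (F j).obj a) :
    W (Subfunctor.homOfLe (hB ⊥)) := by
  refine MorphismProperty.transfiniteCompositionsOfShape_le (W := W) (J := J) _ ⟨?_⟩
  exact
    { F := hF.functor ⋙ subfunctorToFunctor Z
      isoBot := Iso.refl _
      isWellOrderContinuous := ⟨fun j hj => ⟨by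
        have hm : Monotone (fun i : Set.Iio j => F i.1) := fun _ _ h => hF h
        exact isColimitOfIUnion hm (F j) (fun i => hF i.2.le) (fun a x hx => by
          obtain ⟨i, hi, hx⟩ := hlim j hj a x hx
          exact ⟨⟨i, hi⟩, hx⟩)⟩⟩
      incl := { app := fun j => Subfunctor.homOfLe (hB j) }
      isColimit := isColimitOfIUnion hF B hB hB'
      fac := rfl
      map_mem := fun j hj => hsucc j hj }

theorem mem_iff_range_ι_mem [W.RespectsIso] {X Y : C ⥤ Type} (f : X ⟶ Y) [Mono f] :
    W f ↔ W (Subfunctor.range f).ι :=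
  W.arrow_mk_iso_iff (Arrow.isoMk (asIso (Subfunctor.toRange f)) (Iso.refl _) rfl)

/-- Saturation does not mention coproducts, but the small object argument uses them. For
monomorphisms a coproduct is a transfinite composition: the summands are well-ordered and filled in
one at a time. -/
theorem isStableUnderCoproducts_of_mono [W.IsStableUnderCobaseChange] [W.IsStableUnderRetracts]
    [MorphismProperty.IsStableUnderTransfiniteComposition.{0} W]
    (hW : W ≤ MorphismProperty.monomorphisms _) :
    MorphismProperty.IsStableUnderCoproducts.{0} W where
  isStableUnderCoproductsOfShape T := by
    refine .mk _ _ fun X₁ X₂ _ _ f hf => ?_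
    have hmono : ∀ j, Mono (f j) := fun j => hW _ (hf j)
    have : Mono (Limits.Sigma.map f) := inferInstance
    refine (mem_iff_range_ι_mem (W := W) _).2 ?_
    obtain ⟨_, hwf⟩ := exists_wellFoundedLT T
    let _ : SuccOrder (WithTop T) := SuccOrder.ofLinearWellFoundedLT _
    let _ : OrderBot (WithTop T) := WellFoundedLT.toOrderBot _
    -- The strict inequality makes the bottom stage the image of the coproduct map and every limit
    -- stage a union; the added top element is a stage after all summands.
    let F : WithTop T → Subfunctor (∐ X₂) := fun i =>
      Subfunctor.range (Limits.Sigma.map f) ⊔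
        ⨆ (j : T) (_ : (j : WithTop T) < i), Subfunctor.range (Sigma.ι X₂ j)
    have hFmem : ∀ i a (z : (∐ X₂).obj a), z ∈ (F i).obj a ↔
        z ∈ (Subfunctor.range (Limits.Sigma.map f)).obj a ∨
          ∃ j : T, (j : WithTop T) < i ∧ z ∈ Set.range ((Sigma.ι X₂ j).app a) := by
      intro i a z
      simp [F]
    have hF : Monotone F := fun i i' h a z hz => by
      rw [hFmem] at hz ⊢
      exact hz.imp id fun ⟨j, hj, hz⟩ => ⟨j, hj.trans_le h, hz⟩
    have hbot : F ⊥ = Subfunctor.range (Limits.Sigma.map f) := by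
      ext a z
      rw [hFmem]
      simp
    have key := homOfLe_mem_of_transfinite (W := W) hF ?_ ?_ ⊤ (fun _ => le_top) ?_
    · have key' := W.comp_mem _ _ key (W.of_isIso (Subfunctor.ι (⊤ : Subfunctor (∐ X₂))))
      rw [Subfunctor.homOfLe_ι] at key'
      rwa [hbot] at key'
    · intro i hi a z hz
      rcases (hFmem _ _ _).1 hz with hz | ⟨j, hj, hz⟩
      · obtain ⟨i', hi'⟩ := not_isMin_iff.1 hi.not_isMin
        exact ⟨i', hi', (hFmem _ _ _).2 (Or.inl hz)⟩
      · exact ⟨Order.succ (j : WithTop T), hi.succ_lt hj, (hFmem _ _ _).2 (Or.inr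
          ⟨j, Order.lt_succ_of_not_isMax (not_isMax_of_lt hj), hz⟩)⟩
    · intro i hi
      induction i using WithTop.recTopCoe with
      | top => exact absurd isMax_top hi
      | coe j =>
        refine homOfLe_mem_of_attach _ (Sigma.ι X₂ j) ?_ ?_ ?_
        · ext a z
          rw [hFmem]
          change _ ↔ z ∈ (F j).obj a ∨ z ∈ Set.range ((Sigma.ι X₂ j).app a)
          rw [hFmem, or_assoc]
          refine or_congr Iff.rfl ⟨?_, ?_⟩
          · rintro ⟨j', hj', hz⟩
            rcases ((Order.lt_succ_iff_of_not_isMax hi).1 hj').lt_or_eq with h | h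
            · exact Or.inl ⟨j', h, hz⟩
            · obtain rfl := WithTop.coe_injective h
              exact Or.inr hz
          · rintro (⟨j', hj', hz⟩ | hz)
            · exact ⟨j', hj'.trans_le (Order.le_succ _), hz⟩
            · exact ⟨j, Order.lt_succ_of_not_isMax hi, hz⟩
        · exact fun a y y' _ h => sigma_ι_injective X₂ a h
        -- Distinct summands are disjoint, so stage `j` meets the summand `j` only in the image of
        -- `f j`.
        · have e : (F j).preimage (Sigma.ι X₂ j) = Subfunctor.range (f j) := by
            ext a y
            change (Sigma.ι X₂ j).app a y ∈ (F j).obj a ↔ y ∈ Set.range ((f j).app a)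
            have hι : ∀ j y, (Limits.Sigma.map f).app a ((Sigma.ι X₁ j).app a y) =
                (Sigma.ι X₂ j).app a ((f j).app a y) := fun j y =>
              ConcreteCategory.congr_hom (congr_app (Sigma.ι_map f j) a) y
            rw [hFmem]
            constructor
            · rintro (⟨z, hz⟩ | ⟨j', hj', ⟨z, hz⟩⟩)
              · obtain ⟨j', x, rfl⟩ := sigma_ι_jointly_surjective X₁ a z
                rw [hι] at hz
                obtain rfl := sigma_ι_eq X₂ a hz
                exact ⟨x, sigma_ι_injective X₂ a hz⟩
              · obtain rfl := sigma_ι_eq X₂ a hz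
                exact absurd hj' (lt_irrefl _)
            · rintro ⟨x, rfl⟩
              exact Or.inl ⟨(Sigma.ι X₁ j).app a x, hι j x⟩
          rw [e]
          exact (mem_iff_range_ι_mem (W := W) (f j)).1 (hf j)
    · intro a z _
      obtain ⟨j, y, hy⟩ := sigma_ι_jointly_surjective X₂ a z
      exact ⟨⊤, (hFmem _ _ _).2 (Or.inr ⟨j, WithTop.coe_lt_top j, ⟨y, hy⟩⟩)⟩

end Saturated
end Isov

/-! ### The small object argument and the lifting description of anodyne extensions -/

namespace Isov

section SmallObject

variable {C : Type} [Category.{0} C] {ι : Type} {A B : ι → (Cᵒᵖ ⥤ Type)} (f : ∀ i, A i ⟶ B i)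

theorem hasSmallObjectArgument_ofHoms :
    MorphismProperty.HasSmallObjectArgument.{0} (MorphismProperty.ofHoms f) := by
  have hA : ∀ i, ∃ (κ : Cardinal.{0}) (_ : Fact κ.IsRegular), IsCardinalPresentable (A i) κ :=
    fun i => (inferInstance : IsPresentable.{0} (A i)).exists_cardinal
  choose κ hκ hκ' using hA
  -- A single regular cardinal above all presentability ranks; `(κ i).ord.ToType` serves as a type
  -- of cardinality `κ i`.
  obtain ⟨κ', hreg, hlt⟩ := HasCardinalLT.exists_regular_cardinal_forall.{0}
    (fun i => (κ i).ord.ToType)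
  have : Fact κ'.IsRegular := ⟨hreg⟩
  have hle : ∀ i, κ i ≤ κ' := fun i => by
    have h := hlt i
    rw [hasCardinalLT_iff_cardinal_mk_lt] at h
    simpa using h.le
  have : Nonempty κ'.ord.ToType := by simpa using hreg.ne_zero
  have := WellFoundedLT.toOrderBot κ'.ord.ToType
  refine ⟨κ', inferInstance, inferInstance, ?_⟩
  exact
    { isSmall := MorphismProperty.isSmall_ofHoms _
      preservesColimit := by
        intro X Y X' Y' i hi g hg
        obtain ⟨i⟩ := hi
        have := hκ' i
        have := isCardinalPresentable_of_le (A i) (hle i)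
        exact (preservesColimitsOfShape_of_isCardinalPresentable (A i) κ' _).preservesColimit }

/-- The small object argument presents the left class as retracts of transfinite compositions of
pushouts of coproducts of generators. Intersecting `W` with the monomorphisms supplies the closure
under coproducts. -/
theorem llp_rlp_ofHoms_le (hf : ∀ i, Mono (f i)) {W : MorphismProperty (Cᵒᵖ ⥤ Type)}
    (hW : IsSaturated W) (hfW : MorphismProperty.ofHoms f ≤ W) :
    (MorphismProperty.ofHoms f).rlp.llp ≤ W := by
  have := hasSmallObjectArgument_ofHoms f
  have h := hW.inf isSaturated_monomorphisms
  have := h.retracts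
  have := h.pushouts
  have := h.transfinite
  have := isStableUnderCoproducts_of_mono (W := W ⊓ MorphismProperty.monomorphisms _) inf_le_right
  rw [MorphismProperty.llp_rlp_of_hasSmallObjectArgument]
  refine le_trans ?_ (inf_le_left (b := MorphismProperty.monomorphisms _))
  rw [MorphismProperty.retracts_le_iff, MorphismProperty.transfiniteCompositions_le_iff,
    MorphismProperty.pushouts_le_iff, MorphismProperty.coproducts_le_iff]
  refine le_inf hfW ?_
  rintro _ _ _ ⟨i⟩
  exact hf i

end SmallObject

/-- The class of morphisms with the left lifting property against all morphisms with the right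
lifting property against the admissible horn inclusions. -/
abbrev anodyneLLP : MorphismProperty SSetIsov := admissibleHornInclusions.rlp.llp

/-- A left lifting class is itself saturated, which gives one inclusion; the small object argument
gives the other. In lifting form, pushout-products can be handled by adjunction. -/
theorem isovariantAnodyne_eq : isovariantAnodyne = anodyneLLP := by
  refine le_antisymm (fun X Y f hf => ?_) (fun X Y f hf W hW h => ?_)
  · exact hf _ (isSaturated_llp _) (MorphismProperty.le_llp_rlp _)
  · exact llp_rlp_ofHoms_le _ (fun _ => inferInstance) hW h _ hf

theorem isovariantAnodyne_le_monomorphisms :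
    isovariantAnodyne ≤ MorphismProperty.monomorphisms SSetIsov := fun _ _ _ hf =>
  hf _ isSaturated_monomorphisms (by
    rintro _ _ _ ⟨p⟩
    exact (inferInstance : Mono p.1.horn.ι))

end Isov

/-! ### Lifting against inclusions by Zorn's lemma -/

namespace Isov

section Lifting

variable {C : Type} [Category.{0} C] {X Y L : C ⥤ Type}

/-- A lift defined on a subfunctor. -/
structure PartialLift (K : Subfunctor L) (p : X ⟶ Y) (t : K.toFunctor ⟶ X) (b : L ⟶ Y) where
  dom : Subfunctor L
  le : K ≤ dom
  map : dom.toFunctor ⟶ X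
  fac_left : Subfunctor.homOfLe le ≫ map = t
  fac_right : map ≫ p = dom.ι ≫ b

namespace PartialLift

variable {K : Subfunctor L} {p : X ⟶ Y} {t : K.toFunctor ⟶ X} {b : L ⟶ Y}

instance : Preorder (PartialLift K p t b) where
  le x y := ∃ h : x.dom ≤ y.dom, Subfunctor.homOfLe h ≫ y.map = x.map
  le_refl x := ⟨le_rfl, rfl⟩
  le_trans x y z := fun ⟨h, e⟩ ⟨h', e'⟩ => ⟨h.trans h', by rw [← e, ← e']; rfl⟩

theorem le_apply {x y : PartialLift K p t b} (h : x ≤ y) {a : C} (z : L.obj a)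
    (hx : z ∈ x.dom.obj a) (hy : z ∈ y.dom.obj a) :
    x.map.app a ⟨z, hx⟩ = y.map.app a ⟨z, hy⟩ := by
  obtain ⟨h, e⟩ := h
  rw [← e]
  rfl

theorem bddAbove_of_isChain (c : Set (PartialLift K p t b)) (hc : IsChain (· ≤ ·) c)
    (hne : c.Nonempty) : BddAbove c := by
  have huniq : ∀ x ∈ c, ∀ y ∈ c, ∀ (a : C) (z : L.obj a) (hx : z ∈ x.dom.obj a)
      (hy : z ∈ y.dom.obj a), x.map.app a ⟨z, hx⟩ = y.map.app a ⟨z, hy⟩ := by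
    intro x hx y hy a z hzx hzy
    rcases hc.total hx hy with h | h
    · exact le_apply h z hzx hzy
    · exact (le_apply h z hzy hzx).symm
  let M : Subfunctor L :=
    { obj := fun a => {z | ∃ x ∈ c, z ∈ x.dom.obj a}
      map := fun i z ⟨x, hx, hz⟩ => ⟨x, hx, x.dom.map i hz⟩ }
  have hM : ∀ (a : C) (z : M.toFunctor.obj a), ∃ x ∈ c, z.1 ∈ x.dom.obj a := fun a z => z.2
  choose i hic hi using hM
  let φ : M.toFunctor ⟶ X :=
    { app := fun a => ↾fun z => (i a z).map.app a ⟨z.1, hi a z⟩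
      naturality := fun a a' f => by
        ext z
        exact (huniq _ (hic _ _) _ (hic a z) a' _ _ ((i a z).dom.map f (hi a z))).trans
          (NatTrans.naturality_apply (i a z).map f ⟨z.1, hi a z⟩) }
  have hφ : ∀ x ∈ c, ∀ (a : C) (z : L.obj a) (hx : z ∈ x.dom.obj a) (hz : z ∈ M.obj a),
      φ.app a ⟨z, hz⟩ = x.map.app a ⟨z, hx⟩ := fun x hx a z hzx hz =>
    huniq _ (hic a ⟨z, hz⟩) _ hx a z _ _
  have hle : ∀ x ∈ c, x.dom ≤ M := fun x hx a z hz => ⟨x, hx, hz⟩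
  obtain ⟨x₀, hx₀⟩ := hne
  refine ⟨⟨M, x₀.le.trans (hle x₀ hx₀), φ, ?_, ?_⟩, fun x hx => ⟨hle x hx, ?_⟩⟩
  · ext a z
    refine (hφ x₀ hx₀ a z.1 (x₀.le _ z.2) _).trans ?_
    exact ConcreteCategory.congr_hom (congr_app x₀.fac_left a) z
  · ext a z
    exact ConcreteCategory.congr_hom (congr_app (i a z).fac_right a) ⟨z.1, hi a z⟩
  · ext a z
    exact hφ x hx a z.1 z.2 _

end PartialLift

/-- An inclusion has the left lifting property if each larger proper subfunctor can be enlarged. -/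
theorem hasLiftingProperty_ι_of_enlarge (K : Subfunctor L) (p : X ⟶ Y)
    (h : ∀ M : Subfunctor L, K ≤ M → M ≠ ⊤ →
      ∃ (M' : Subfunctor L) (hM : M ≤ M'), M ≠ M' ∧ HasLiftingProperty (Subfunctor.homOfLe hM) p) :
    HasLiftingProperty K.ι p := by
  refine ⟨fun {t b} sq => ?_⟩
  have : Nonempty (PartialLift K p t b) := ⟨⟨K, le_rfl, t, rfl, sq.w⟩⟩
  obtain ⟨x, hx⟩ := zorn_le_nonempty (α := PartialLift K p t b)
    PartialLift.bddAbove_of_isChain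
  have htop : x.dom = ⊤ := by
    by_contra hne
    obtain ⟨M', hM, hne', hlift⟩ := h x.dom x.le hne
    have sq' : CommSq x.map (Subfunctor.homOfLe hM) p (M'.ι ≫ b) := ⟨x.fac_right⟩
    let y : PartialLift K p t b := ⟨M', x.le.trans hM, sq'.lift,
      (congrArg (Subfunctor.homOfLe x.le ≫ ·) sq'.fac_left).trans x.fac_left, sq'.fac_right⟩
    have hxy : x ≤ y := ⟨hM, sq'.fac_left⟩
    exact hne' (le_antisymm hM (hx hxy).1)
  obtain ⟨M, hKM, φ, h₁, h₂⟩ := x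
  obtain rfl : M = ⊤ := htop
  refine ⟨⟨⟨inv (Subfunctor.ι (⊤ : Subfunctor L)) ≫ φ, ?_, ?_⟩⟩⟩
  · rw [← h₁, ← Subfunctor.homOfLe_ι hKM, Category.assoc, IsIso.hom_inv_id_assoc]
  · rw [Category.assoc, h₂, IsIso.inv_hom_id_assoc]

end Lifting

/-! ### Pushout-products of inclusions -/

section UnionProd

variable {C : Type} [Category.{0} C] {J L : C ⥤ Type}

/-- The subfunctor `A ⊗ L ∪ J ⊗ M` of `J ⊗ L`. -/
def unionProd (A : Subfunctor J) (M : Subfunctor L) : Subfunctor (J ⊗ L) where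
  obj a := {z : J.obj a × L.obj a | z.1 ∈ A.obj a ∨ z.2 ∈ M.obj a}
  map f := by
    rintro ⟨x, y⟩ (h | h)
    · exact Or.inl (A.map f h)
    · exact Or.inr (M.map f h)

/-- The inclusion of `J ⊗ M`. -/
def unionProdInl (A : Subfunctor J) (M : Subfunctor L) :
    J ⊗ M.toFunctor ⟶ (unionProd A M).toFunctor where
  app a := ↾fun (z : J.obj a × M.obj a) => ⟨(z.1, z.2.1), Or.inr z.2.2⟩

/-- The inclusion of `A ⊗ L`. -/
def unionProdInr (A : Subfunctor J) (M : Subfunctor L) :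
    A.toFunctor ⊗ L ⟶ (unionProd A M).toFunctor where
  app a := ↾fun (z : A.obj a × L.obj a) => ⟨(z.1.1, z.2), Or.inl z.1.2⟩

/-- The pushout-product of inclusions. -/
def unionProdPushoutObjObj (A : Subfunctor J) (M : Subfunctor L) :
    (MonoidalCategory.curriedTensor (C ⥤ Type)).PushoutObjObj A.ι M.ι where
  pt := (unionProd A M).toFunctor
  inl := unionProdInl A M
  inr := unionProdInr A M
  isPushout := by
    refine isPushout_of_elementwise rfl ?_ ?_ ?_ ?_ ?_
    · rintro a ⟨x, y⟩ ⟨x', y'⟩ h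
      have h' : (x, y.1) = (x', y'.1) := congrArg Subtype.val h
      obtain ⟨rfl, h₂⟩ := Prod.mk.inj h'
      obtain rfl := Subtype.ext h₂
      rfl
    · rintro a ⟨x, y⟩ ⟨x', y'⟩ h h'
      have h₁ : (x.1, y) = (x'.1, y') := h
      exact Prod.ext (Subtype.ext (Prod.mk.inj h₁).1) (Prod.mk.inj h₁).2
    · rintro a ⟨⟨x, y⟩, h | h⟩
      · exact Or.inr ⟨(⟨x, h⟩, y), rfl⟩
      · exact Or.inl ⟨(x, ⟨y, h⟩), rfl⟩
    · rintro a ⟨x, y⟩ ⟨x', y'⟩ h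
      have h' : (x, y.1) = (x'.1, y') := congrArg Subtype.val h
      obtain ⟨rfl, h₂⟩ := Prod.mk.inj h'
      exact ⟨(x', y), congrArg (Prod.mk x') h₂⟩
    · rintro a ⟨x, y⟩ ⟨x', y'⟩ - - h
      have h' : (x.1, y) = (x'.1, y') := congrArg Subtype.val h
      exact Prod.ext (Subtype.ext (Prod.mk.inj h').1) (Prod.mk.inj h').2
  ι := (unionProd A M).ι
  inl_ι := rfl
  inr_ι := rfl

/-- Pushout-products with a fixed inclusion: it suffices to look at generators. -/
theorem unionProd_mem_llp (A : Subfunctor J) {T : MorphismProperty (C ⥤ Type)} {ι : Type}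
    {D : ι → (C ⥤ Type)} (N : ∀ i, Subfunctor (D i)) (hN : ∀ i, T.llp (unionProd A (N i)).ι)
    (M : Subfunctor L) (hM : (MorphismProperty.ofHoms (fun i => (N i).ι)).rlp.llp M.ι) :
    T.llp (unionProd A M).ι := by
  intro X Y p hp
  -- Lifting `unionProd A M` against `p` is the same as lifting `M` against the pullback-hom of
  -- `A.ι` and `p`; the assumption on generators places this pullback-hom in their right class.
  refine (ParametrizedAdjunction.hasLiftingProperty_iff MonoidalClosed.internalHomAdjunction₂
    (unionProdPushoutObjObj A M) (Functor.PullbackObjObj.ofHasPullback _ A.ι p)).2 (hM _ ?_)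
  rintro _ _ _ ⟨i⟩
  exact (ParametrizedAdjunction.hasLiftingProperty_iff MonoidalClosed.internalHomAdjunction₂
    (unionProdPushoutObjObj A (N i)) (Functor.PullbackObjObj.ofHasPullback _ A.ι p)).1 (hN i _ hp)

/-- An inclusion `M → L` is a retract of `A ⊗ L ∪ J ⊗ M → J ⊗ L` if `J ⊗ L` retracts onto `L`
compatibly. -/
def retractUnionProd (A : Subfunctor J) (M : Subfunctor L) (e : L ⟶ J) (r : J ⊗ L ⟶ L)
    (h : ∀ a (y : L.obj a), r.app a ((e.app a y, y) : J.obj a × L.obj a) = y)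
    (hr : ∀ a (z : J.obj a × L.obj a), z ∈ (unionProd A M).obj a → r.app a z ∈ M.obj a) :
    RetractArrow M.ι (unionProd A M).ι where
  i := Arrow.homMk
    (Subfunctor.lift (M.ι ≫ CartesianMonoidalCategory.lift e (𝟙 L)) (by
      rintro a _ ⟨y, rfl⟩
      exact Or.inr y.2))
    (CartesianMonoidalCategory.lift e (𝟙 L)) rfl
  r := Arrow.homMk
    (Subfunctor.lift ((unionProd A M).ι ≫ r) (by
      rintro a _ ⟨z, rfl⟩
      exact hr a z.1 z.2)) r rfl
  retract := by
    ext a y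
    · exact Subtype.ext (h a y.1)
    · exact h a y

end UnionProd
end Isov

/-! ### Faces, sections and epimorphisms in the isovariant simplex category -/

namespace Isov

namespace GDelta

variable {a b c : GDelta}

theorem exists_succAbove_comp {m n : ℕ} (φ : Fin (n + 1) →o Fin (m + 2)) (i : Fin (m + 2))
    (h : ∀ j, φ j ≠ i) : ∃ χ : Fin (n + 1) →o Fin (m + 1), ∀ j, i.succAbove (χ j) = φ j := by
  choose χ hχ using fun j => Fin.exists_succAbove_eq (h j)
  refine ⟨⟨χ, fun j j' hj => ?_⟩, hχ⟩
  have h' := φ.monotone hj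
  rw [← hχ j, ← hχ j'] at h'
  exact (Fin.succAboveOrderEmb i).le_iff_le.1 h'

theorem mem_range_d0 {m k : ℕ} {i : Fin (m + 2)} (hi : k ≤ (i : ℕ)) (hk : k ≤ m + 2)
    (f : b ⟶ (⟨m + 1, k, hk⟩ : GDelta)) :
    (∃ f' : b ⟶ ⟨m, k, by omega⟩, f' ≫ d0 m k i hi = f) ↔ ∀ j, shape f j ≠ i := by
  constructor
  · rintro ⟨f', rfl⟩ j
    rw [shape_comp]
    exact Fin.succAbove_ne i _
  · intro h
    obtain ⟨χ, hχ⟩ := exists_succAbove_comp (shape f) i h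
    obtain ⟨f', -, h'⟩ := exists_lift (b := ⟨m, k, by omega⟩) f _ (shape_real (d0 m k i hi)) χ hχ
    exact ⟨f', h'⟩

theorem mem_range_d1 {m k : ℕ} {i : Fin (m + 2)} (hi : (i : ℕ) < k) (hk : k ≤ m + 2)
    (f : b ⟶ (⟨m + 1, k, hk⟩ : GDelta)) :
    (∃ f' : b ⟶ ⟨m, k - 1, by omega⟩, f' ≫ d1 m k hk i hi = f) ↔ ∀ j, shape f j ≠ i := by
  constructor
  · rintro ⟨f', rfl⟩ j
    rw [shape_comp]
    exact Fin.succAbove_ne i _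
  · intro h
    obtain ⟨χ, hχ⟩ := exists_succAbove_comp (shape f) i h
    obtain ⟨f', -, h'⟩ := exists_lift (b := ⟨m, k - 1, by omega⟩) f _
      (shape_real (d1 m k hk i hi)) χ hχ
    exact ⟨f', h'⟩

/-- A morphism which is not surjective factors through an object of smaller dimension. -/
theorem exists_fac_of_not_surjective (f : b ⟶ a) (hf : ¬ Function.Surjective (shape f)) :
    ∃ (c : GDelta) (f' : b ⟶ c) (d : c ⟶ a), c.n < a.n ∧ f' ≫ d = f := by
  obtain ⟨i, hi⟩ := not_forall.1 hf
  have hi' : ∀ j, shape f j ≠ i := fun j hj => hi ⟨j, hj⟩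
  rcases a with ⟨_ | m, k, hk⟩
  · exact absurd (Subsingleton.elim (α := Fin 1) _ _) (hi' 0)
  · by_cases h : (i : ℕ) < k
    · obtain ⟨f', h'⟩ := (mem_range_d1 h hk f).2 hi'
      exact ⟨_, f', _, Nat.lt_succ_self m, h'⟩
    · obtain ⟨f', h'⟩ := (mem_range_d0 (not_lt.1 h) hk f).2 hi'
      exact ⟨_, f', _, Nat.lt_succ_self m, h'⟩

theorem exists_twist_eq {f : a ⟶ b} {φ : Fin (a.n + 1) →o Fin (b.n + 1)}
    (hφ : ∀ j : Fin (a.n + 1), a.k ≤ (j : ℕ) ↔ b.k ≤ (φ j : ℕ)) (h : shape f = φ) :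
    ∃ g : C2, f = a.twist g ≫ homOfOrderHom φ hφ := by
  subst h
  exact exists_eq_twist_comp f

/-- An endomorphism which is surjective is a twist. -/
theorem exists_eq_twist (f : a ⟶ a) (hf : Function.Surjective (shape f)) :
    shape f = OrderHom.id ∧ ∃ g, f = a.twist g := by
  have hinj : Function.Injective (shape f) := Finite.injective_iff_surjective.2 hf
  have hid : shape f = OrderHom.id := by
    ext1
    refine (StrictMono.range_inj ((shape f).monotone.strictMono_of_injective hinj)
      strictMono_id).1 ?_
    rw [hf.range_eq]
    exact Set.range_id.symm
  refine ⟨hid, ?_⟩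
  obtain ⟨g, hg⟩ := exists_twist_eq (fun _ => Iff.rfl) hid
  have h₁ : homOfOrderHom (a := a) (b := a) OrderHom.id (fun _ => Iff.rfl) = 𝟙 a :=
    hom_ext fun _ => rfl
  exact ⟨g, by rw [hg, h₁, Category.comp_id]⟩

/-- A surjective morphism has sections through each vertex. -/
theorem exists_section (f : b ⟶ a) (hf : Function.Surjective (shape f)) (j : Fin (b.n + 1)) :
    ∃ s : a ⟶ b, s ≫ f = 𝟙 a ∧ shape s (shape f j) = j := by
  obtain ⟨σ₀, hσ₀⟩ := hf.hasRightInverse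
  let σ : Fin (a.n + 1) → Fin (b.n + 1) := Function.update σ₀ (shape f j) j
  have hσ : ∀ i, shape f (σ i) = i := by
    intro i
    by_cases h : i = shape f j
    · subst h; simp [σ]
    · simp [σ, Function.update_of_ne h, hσ₀ i]
  -- Any set-theoretic section of a monotone map between chains is monotone, so the value at one
  -- index may be prescribed freely.
  have hσm : Monotone σ := by
    intro i i' h
    by_contra hlt
    have := (shape f).monotone (not_le.1 hlt).le
    rw [hσ, hσ] at this
    obtain rfl := le_antisymm h this
    exact hlt le_rfl
  obtain ⟨g, hg⟩ := exists_eq_twist_comp f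
  obtain ⟨s, hs, hs'⟩ := exists_lift (𝟙 a) (shape f) (shape_real f) ⟨σ, hσm⟩ hσ
  refine ⟨s ≫ b.twist g⁻¹, ?_, ?_⟩
  · have : b.twist g⁻¹ ≫ b.twist g = 𝟙 b := by rw [twist_mul, mul_inv_cancel, twist_one]
    conv_lhs => rw [hg]
    rw [Category.assoc, reassoc_of% this, hs']
  · rw [shape_comp, shape_twist, hs]
    exact Function.update_self _ _ _

/-- If the index `i` is missed, the two cofaces that insert a new index just before or just after
`i` agree on the image of `f`, yet they differ at `i`. -/
theorem surjective_of_epi (f : a ⟶ b) [Epi f] : Function.Surjective (shape f) := by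
  by_contra hf
  obtain ⟨i, hi⟩ := not_forall.1 hf
  have hi' : ∀ j, shape f j ≠ i := fun j hj => hi ⟨j, hj⟩
  have key : ∀ {c : GDelta} (d d' : b ⟶ c), (∀ j u, j ≠ i →
      (asHom d).toFun (b.vertex j u) = (asHom d').toFun (b.vertex j u)) → d = d' := by
    intro c d d' h
    rw [← cancel_epi f]
    refine hom_ext fun j => ?_
    obtain ⟨u, hu⟩ := Vertex.exists_eq_mk (n := b.n) (k := b.k) ((asHom f).toFun (a.vertex j 1))
    exact (congrArg (asHom d).toFun hu).trans ((h _ u (hi' j)).trans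
      (congrArg (asHom d').toFun hu).symm)
  have hs : ∀ j, j ≠ i → i.castSucc.succAbove j = i.succ.succAbove j := by
    intro j hj
    rcases lt_or_gt_of_ne hj with h | h
    · rw [Fin.succAbove_of_castSucc_lt _ _ (Fin.castSucc_lt_castSucc_iff.2 h),
        Fin.succAbove_of_castSucc_lt _ _ (Fin.castSucc_lt_succ_iff.2 h.le)]
    · rw [Fin.succAbove_of_le_castSucc _ _ (Fin.castSucc_le_castSucc_iff.2 h.le),
        Fin.succAbove_of_le_castSucc _ _ (Fin.succ_le_castSucc_iff.2 h)]
  have hne : i.castSucc.succAbove i ≠ i.succ.succAbove i := by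
    rw [Fin.succAbove_castSucc_self, Fin.succAbove_succ_self]
    exact (Fin.castSucc_lt_succ).ne'
  rcases b with ⟨n, k, hk⟩
  by_cases h : k ≤ (i : ℕ)
  · have := key (d0 n k i.castSucc h) (d0 n k i.succ (h.trans (Nat.le_succ _)))
      (fun j u hj => congrArg (fun l => Vertex.mk l u) (hs j hj))
    exact hne (congrArg (fun q => shape q i) this)
  -- The inserted index is non-real like `i`, so the target has `k + 1` non-real indices.
  · have := key (d1 n (k + 1) (Nat.succ_le_succ hk) i.castSucc (by simp only [Fin.val_castSucc]; omega))
      (d1 n (k + 1) (Nat.succ_le_succ hk) i.succ (by simp only [Fin.val_succ]; omega))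
      (fun j u hj => congrArg (fun l => Vertex.mk l u) (hs j hj))
    exact hne (congrArg (fun q => shape q i) this)

/-- The automorphism given by a group element. -/
def twistIso (a : GDelta) (g : C2) : a ≅ a where
  hom := a.twist g
  inv := a.twist g⁻¹
  hom_inv_id := by rw [twist_mul, inv_mul_cancel, twist_one]
  inv_hom_id := by rw [twist_mul, mul_inv_cancel, twist_one]

end GDelta

/-! ### Free objects and their cell decompositions along boundaries -/

open GDelta

/-- The boundary of the standard simplex. -/
def boundary (a : GDelta) : Subfunctor (stdSimplex a) where
  obj b := {f : b.unop ⟶ a | ¬ Function.Surjective (shape f)}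
  map {b c} g f hf := fun h => hf fun i => by
    obtain ⟨j, hj⟩ := h i
    exact ⟨shape g.unop j, by rw [← hj]; exact (shape_comp g.unop f j).symm⟩

/-- An isovariant simplicial set on whose simplices the group acts freely, except for the totally
real ones. -/
def IsFree (X : SSetIsov) : Prop :=
  ∀ (a : GDelta) (x : X.obj (op a)) (g : C2), X.map (a.twist g).op x = x → a.twist g = 𝟙 a

/-- An equation fixing a simplex is carried along by any map. Freeness is thus inherited by every
object over a free base, a form of normality suited to slices. -/
theorem IsFree.of_hom {X Y : SSetIsov} (f : X ⟶ Y) (hY : IsFree Y) : IsFree X := by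
  intro a x g h
  refine hY a (f.app _ x) g ?_
  rw [← NatTrans.naturality_apply, h]

/-- If the source has a non-real vertex, then `[0, 1]` is one; its image is non-real too, and only
the identity of `G` fixes it. -/
theorem isFree_stdSimplex (a : GDelta) : IsFree (stdSimplex a) := by
  intro b f g h
  by_cases hb : b.k = 0
  · exact twist_eq_id hb g
  · have ha : a.k ≠ 0 := fun ha => hb (by
      have := (shape_real (show b ⟶ a from f) 0).2 (by omega)
      simpa using this)
    have h' : b.twist g ≫ (show b ⟶ a from f) = f := h
    obtain ⟨u, hu⟩ := exists_eq_twist_comp (show b ⟶ a from f)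
    have h₁ := congrArg (fun q : b ⟶ a => (asHom q).toFun (b.vertex 0 1)) h'
    rw [hu] at h₁
    obtain ⟨-, h₂⟩ := Vertex.mk_eq_mk.1 h₁
    rcases h₂ with h₂ | h₂
    · have : g = 1 := by simpa using h₂
      rw [this, twist_one]
    · have := (shape_real (show b ⟶ a from f) 0).2 h₂
      simp at this
      exact absurd this hb

/-- Twists commute with all morphisms, so pulling back along a section of `π` moves the fixing
equation to the dominant simplex `u`, where only the identity automorphism is allowed. -/
theorem IsNormal.isFree {X : SSetIsov} (hX : IsNormal X) : IsFree X := by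
  intro a x g h
  obtain ⟨c, π, u, hπ, hu, rfl⟩ := hX a x
  obtain ⟨s, hs, -⟩ := exists_section π (surjective_of_epi π) 0
  have h₁ : X.map (c.twist g).op u = u := by
    have h₂ : X.map (a.twist g ≫ π).op u = X.map π.op u := by
      rw [op_comp, X.map_comp]; exact h
    have h₃ := congrArg (fun z => X.map s.op z) h₂
    simp only [← Functor.map_comp_apply, ← op_comp] at h₃
    rwa [twist_comp, reassoc_of% hs, hs, op_id, X.map_id] at h₃
  have h₂ : c.twist g = 𝟙 c := congrArg Iso.hom (hu.2 (c.twistIso g) h₁)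
  by_cases ha : a.k = 0
  · exact twist_eq_id ha g
  · have hc : c.k ≠ 0 := fun hc => ha (by
      have := (shape_real π 0).2 (by omega)
      simpa using this)
    rw [eq_one_of_twist_eq_id hc h₂, twist_one]

/-- A simplex of least dimension outside `M` is attached along its boundary: its proper faces lie in
`M` by minimality, while a surjective degeneracy of it has a section that recovers `x`. For
injectivity, a section `s` of `f` makes `s ≫ g` fix `x`, so it is a twist, and freeness makes it the
identity. Thus `f` and `g` have the same sections, which determines them. -/
theorem cell_of_minimal {L : SSetIsov} (hL : IsFree L) (M : Subfunctor L) (a : GDelta)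
    (x : L.obj (op a)) (hx : x ∉ M.obj (op a))
    (hmin : ∀ (b : GDelta) (y : L.obj (op b)), b.n < a.n → y ∈ M.obj (op b)) :
    M.preimage (yonedaEquiv.symm x) = boundary a ∧
      ∀ (b : GDeltaᵒᵖ) (f g : (stdSimplex a).obj b), (yonedaEquiv.symm x).app b f ∉ M.obj b →
        (yonedaEquiv.symm x).app b f = (yonedaEquiv.symm x).app b g → f = g := by
  have hmem : ∀ (b : GDelta) (f : b ⟶ a), L.map f.op x ∈ M.obj (op b) ↔
      ¬ Function.Surjective (shape f) := by
    intro b f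
    constructor
    · intro h hf
      obtain ⟨s, hs, -⟩ := exists_section f hf 0
      refine hx ?_
      have := M.map s.op h
      rwa [Set.mem_preimage, ← Functor.map_comp_apply, ← op_comp, hs, op_id, L.map_id] at this
    · intro hf
      obtain ⟨c, f', d, hc, rfl⟩ := exists_fac_of_not_surjective f hf
      rw [op_comp, L.map_comp]
      exact M.map f'.op (hmin c _ hc)
  have happ : ∀ (b : GDelta) (f : b ⟶ a), (yonedaEquiv.symm x).app (op b) f = L.map f.op x :=
    fun b f => rfl
  constructor
  · ext ⟨b⟩ f
    exact hmem b f
  · rintro ⟨b⟩ f g hf hfg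
    change b ⟶ a at f g
    rw [happ] at hf
    rw [happ, happ] at hfg
    have hfs := not_not.1 ((hmem b f).not.1 hf)
    have hsec : ∀ s : a ⟶ b, s ≫ f = 𝟙 a → s ≫ g = 𝟙 a := by
      intro s hs
      have h₁ := congrArg (fun z => L.map s.op z) hfg
      simp only [← Functor.map_comp_apply, ← op_comp] at h₁
      rw [hs, op_id, L.map_id] at h₁
      have h₁ : L.map (s ≫ g).op x = x := h₁.symm
      have h₂ : Function.Surjective (shape (s ≫ g)) := by
        by_contra h
        rw [← hmem, h₁] at h
        exact hx h
      obtain ⟨-, t, ht⟩ := exists_eq_twist _ h₂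
      rw [ht] at h₁ ⊢
      exact hL _ _ _ h₁
    have hshape : shape f = shape g := by
      ext1; funext j
      obtain ⟨s, hs, hsj⟩ := exists_section f hfs j
      have h₁ := congrArg (fun q => shape q (shape f j)) (hsec s hs)
      simp only [shape_comp, hsj, shape_id] at h₁
      exact h₁.symm
    obtain ⟨s, hs, -⟩ := exists_section f hfs 0
    have hs' := hsec s hs
    -- With equal order maps, `f` and `g` can only differ by twists `u` and `v`. The common section
    -- turns these into twists of `a`, compared after cancelling the invertible twist `w`.
    obtain ⟨u, hu⟩ := exists_twist_eq (shape_real g) hshape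
    obtain ⟨v, hv⟩ := exists_eq_twist_comp g
    have hq : ∀ w, s ≫ b.twist w ≫ homOfOrderHom (shape g) (shape_real g) =
        (s ≫ homOfOrderHom (shape g) (shape_real g)) ≫ a.twist w := fun w => by
      rw [twist_comp, Category.assoc]
    rw [hu, hq] at hs
    rw [hv] at hs'
    change s ≫ b.twist v ≫ homOfOrderHom (shape g) (shape_real g) = _ at hs'
    rw [hq] at hs'
    have hq' : Function.Surjective
        (shape (s ≫ homOfOrderHom (shape g) (shape_real g))) := by
      intro i
      refine ⟨i, ?_⟩
      have := congrArg (fun q => shape q i) hs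
      simpa using this
    obtain ⟨-, w, hw⟩ := exists_eq_twist _ hq'
    have huv : a.twist u = a.twist v := by
      rw [hw] at hs hs'
      rw [← cancel_epi (a.twistIso w).hom]
      exact hs.trans hs'.symm
    rw [hu, hv]
    change b.twist u ≫ homOfOrderHom (shape g) (shape_real g) =
      b.twist v ≫ homOfOrderHom (shape g) (shape_real g)
    rw [twist_comp, twist_comp, huv]

/-- The boundary inclusions. -/
abbrev boundaryInclusions : MorphismProperty SSetIsov :=
  MorphismProperty.ofHoms (fun a : GDelta => (boundary a).ι)

/-- Inclusions into free objects are generated by the boundary inclusions. -/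
theorem boundaryInclusions_rlp_llp_ι {L : SSetIsov} (hL : IsFree L) (K : Subfunctor L) :
    boundaryInclusions.rlp.llp K.ι := by
  intro X Y p hp
  refine hasLiftingProperty_ι_of_enlarge K p fun M _ hM => ?_
  -- It is enough to enlarge `M` by one cell; a missing simplex of least dimension provides it.
  have hex : ∃ n : ℕ, ∃ (a : GDelta) (x : L.obj (op a)), a.n = n ∧ x ∉ M.obj (op a) := by
    by_contra h
    push Not at h
    refine hM ?_
    ext ⟨a⟩ x
    simpa using h _ a x rfl
  classical
  obtain ⟨a, x, ha, hx⟩ := Nat.find_spec hex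
  obtain ⟨h₁, h₂⟩ := cell_of_minimal hL M a x hx (fun b y hb => by
    by_contra hy
    exact Nat.find_min hex (ha ▸ hb) ⟨b, y, rfl, hy⟩)
  refine ⟨M ⊔ Subfunctor.range (yonedaEquiv.symm x), le_sup_left, fun h => hx ?_, ?_⟩
  · rw [h]
    exact Or.inr ⟨𝟙 a, by simp⟩
  · refine homOfLe_mem_of_attach (W := boundaryInclusions.rlp.llp) le_sup_left
      (yonedaEquiv.symm x) rfl h₂ ?_ p hp
    rw [h₁]
    exact MorphismProperty.le_llp_rlp _ _ ⟨a⟩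

end Isov

/-! ### The interval, and prisms filled by admissible horns -/

namespace Isov

open GDelta

/-- The interval: `G`-invariant order-preserving maps into `{0 < 1}`. -/
def interval : SSetIsov where
  obj b := Fin (b.unop.n + 1) →o Fin 2
  map f := ↾fun t => t.comp (shape f.unop)
  map_comp f g := by
    ext t : 3
    change t.comp (shape (g.unop ≫ f.unop)) = (t.comp (shape f.unop)).comp (shape g.unop)
    ext1; funext i
    exact congrArg t (shape_comp g.unop f.unop i)

/-- The end `ε` of the interval. -/
def intervalEnd (ε : Fin 2) : Subfunctor interval where
  obj b := {t : Fin (b.unop.n + 1) →o Fin 2 | ∀ i, t i = ε}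
  map _ _ ht := fun _ => ht _

/-- The two ends of the interval. -/
def intervalBdry : Subfunctor interval where
  obj b := {t : Fin (b.unop.n + 1) →o Fin 2 | ∃ ε, ∀ i, t i = ε}
  map _ _ ht := ht.imp fun _ h _ => h _

/-! ### Horns -/

theorem mem_horn (p : HornIndex) {b : GDelta} (f : b ⟶ p.top) :
    f ∈ p.horn.obj (op b) ↔ ∃ i, i ≠ p.l ∧ ∀ j, shape f j ≠ i := by
  have h₁ : ∀ (i : Fin (p.m + 2)) (hi : (i : ℕ) < p.k),
      f ∈ (Subfunctor.range (yoneda.map (GDelta.d1 p.m p.k p.hk i hi))).obj (op b) ↔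
        ∀ j, shape f j ≠ i := fun i hi => mem_range_d1 hi p.hk f
  have h₀ : ∀ (i : Fin (p.m + 2)) (hi : p.k ≤ (i : ℕ)),
      f ∈ (Subfunctor.range (yoneda.map (GDelta.d0 p.m p.k i hi))).obj (op b) ↔
        ∀ j, shape f j ≠ i := fun i hi => mem_range_d0 hi p.hk f
  unfold HornIndex.horn
  simp only [Subfunctor.max_obj, Subfunctor.iSup_obj, Set.mem_union, Set.mem_iUnion]
  constructor
  · rintro (⟨i, hi, hl, h⟩ | ⟨i, hi, hl, h⟩)
    · exact ⟨i, hl, (h₁ i hi).1 h⟩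
    · exact ⟨i, hl, (h₀ i hi).1 h⟩
  · rintro ⟨i, hl, h⟩
    by_cases hi : (i : ℕ) < p.k
    · exact Or.inl ⟨i, hi, hl, (h₁ i hi).2 h⟩
    · exact Or.inr ⟨i, not_lt.1 hi, hl, (h₀ i (not_lt.1 hi)).2 h⟩

/-- A surjective morphism has a section, so precomposing with it does not shrink the image. The
image condition in admissibility is therefore automatic, and only the types of `l` and its neighbour
matter. -/
theorem range_yoneda_comp {a b c : GDelta} (s : a ⟶ b) (d : b ⟶ c)
    (hs : Function.Surjective (shape s)) :
    Subfunctor.range (yoneda.map (s ≫ d)) = Subfunctor.range (yoneda.map d) := by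
  obtain ⟨t, ht, -⟩ := exists_section s hs 0
  ext ⟨e⟩ f
  constructor
  · rintro ⟨g, rfl⟩
    exact ⟨(show e ⟶ a from g) ≫ s, Category.assoc (show e ⟶ a from g) s d⟩
  · rintro ⟨g, rfl⟩
    refine ⟨(show e ⟶ b from g) ≫ t, ?_⟩
    change ((show e ⟶ b from g) ≫ t) ≫ s ≫ d = (show e ⟶ b from g) ≫ d
    rw [Category.assoc, reassoc_of% ht]

theorem isAdmissible_of_neighbour (p : HornIndex) (a : Fin (p.m + 1))
    (ha : (a : ℕ) = (p.l : ℕ) ∨ (a : ℕ) + 1 = (p.l : ℕ))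
    (h : ((p.l : ℕ) < p.k ∧ (a : ℕ) + 1 < p.k) ∨ (p.k ≤ (p.l : ℕ) ∧ p.k ≤ (a : ℕ))) :
    p.IsAdmissible :=
  ⟨a, ha, h.imp
    (fun h => ⟨h.1, h.2, range_yoneda_comp _ _ (Fin.predAbove_surjective a)⟩)
    (fun h => ⟨h.1, h.2, range_yoneda_comp _ _ (Fin.predAbove_surjective a)⟩)⟩

theorem anodyneLLP_horn (p : HornIndex) (hp : p.IsAdmissible) : anodyneLLP p.horn.ι :=
  MorphismProperty.le_llp_rlp _ _ ⟨(⟨p, hp⟩ : {p : HornIndex // p.IsAdmissible})⟩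

/-! ### Prisms -/

section Prism

variable (a : GDelta) (i : Fin (a.n + 1))

theorem val_predAbove {n : ℕ} (i : Fin (n + 1)) (j : Fin (n + 2)) :
    ((i.predAbove j : Fin (n + 1)) : ℕ) = if (j : ℕ) ≤ i then (j : ℕ) else j - 1 := by
  simp only [Fin.predAbove, Fin.lt_def, Fin.val_castSucc]
  split_ifs <;> (simp; try omega)

/-- The number of non-real indices of the `i`-th cell of the prism. -/
def prismReal : ℕ := if (i : ℕ) < a.k then a.k + 1 else a.k

/-- The horn `l` in the `i`-th cell of the prism over `a`. -/
def prismHorn (l : Fin (a.n + 2)) : HornIndex where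
  m := a.n
  k := prismReal a i
  hk := by
    have := a.hk
    unfold prismReal
    split_ifs <;> omega
  l := l

/-- The shape of the `i`-th cell. -/
abbrev prismObj : GDelta := (prismHorn a i 0).top

/-- The degeneracy of the `i`-th cell. -/
def prismDegen : prismObj a i ⟶ a :=
  homOfOrderHom (a := prismObj a i) (b := a)
    ⟨Fin.predAbove i, Fin.predAbove_right_monotone i⟩ (fun (j : Fin (a.n + 2)) => by
      show prismReal a i ≤ (j : ℕ) ↔ a.k ≤ ((i.predAbove j : Fin (a.n + 1)) : ℕ)
      rw [val_predAbove, prismReal]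
      split_ifs <;> omega)

/-- The level function of the `i`-th cell. -/
def prismLevel : Fin (a.n + 2) →o Fin 2 where
  toFun j := if (j : ℕ) ≤ i then 0 else 1
  monotone' j j' h := by
    have h' : (j : ℕ) ≤ j' := h
    dsimp only
    split_ifs <;> first | exact le_rfl | exact Fin.zero_le _ | omega

theorem prismLevel_eq_zero (j : Fin (a.n + 2)) : prismLevel a i j = 0 ↔ (j : ℕ) ≤ i := by
  change (if (j : ℕ) ≤ i then (0 : Fin 2) else 1) = 0 ↔ _
  split_ifs with h <;> simp [h]

theorem prismLevel_eq_one (j : Fin (a.n + 2)) : prismLevel a i j = 1 ↔ (i : ℕ) < j := by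
  change (if (j : ℕ) ≤ i then (0 : Fin 2) else 1) = 1 ↔ _
  split_ifs with h
  · simp [h]
  · simp [not_le.1 h]

/-- The `i`-th cell of the prism over `a`. -/
def prismCell : stdSimplex (prismObj a i) ⟶ interval ⊗ stdSimplex a :=
  yonedaEquiv.symm ((prismLevel a i, prismDegen a i) :
    (Fin (a.n + 2) →o Fin 2) × (prismObj a i ⟶ a))

variable {a i}

theorem prismCell_app {b : GDelta} (f : b ⟶ prismObj a i) :
    (prismCell a i).app (op b) f =
      (((prismLevel a i).comp (shape f), f ≫ prismDegen a i) :
        (Fin (b.n + 1) →o Fin 2) × (b ⟶ a)) := rfl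

theorem val_shape_comp_prismDegen {b : GDelta} (f : b ⟶ prismObj a i) (x : Fin (b.n + 1)) :
    (shape (f ≫ prismDegen a i) x : ℕ) =
      if (shape f x : ℕ) ≤ i then (shape f x : ℕ) else shape f x - 1 := by
  rw [shape_comp]
  exact val_predAbove i _

/-- The level separates the two indices that the degeneracy identifies, so level and projection
determine the order map; `eq_of_comp_eq` then settles the group elements. -/
theorem prismCell_injective (b : GDeltaᵒᵖ) (f g : (stdSimplex (prismObj a i)).obj b)
    (h : (prismCell a i).app b f = (prismCell a i).app b g) : f = g := by
  induction b using Opposite.rec with | _ b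
  change b ⟶ prismObj a i at f g
  rw [prismCell_app, prismCell_app] at h
  obtain ⟨h₁, h₂⟩ := Prod.mk.inj h
  refine eq_of_comp_eq (prismDegen a i) ?_ h₂
  ext1; funext x
  have h₃ := congrArg (fun t => (t x : Fin 2)) h₁
  have h₄ := congrArg (fun q : b ⟶ a => (shape q x : ℕ)) h₂
  simp only [val_shape_comp_prismDegen] at h₄
  have h₅ : (shape f x : ℕ) ≤ i ↔ (shape g x : ℕ) ≤ i :=
    (prismLevel_eq_zero a i _).symm.trans ((Eq.congr_left h₃).trans (prismLevel_eq_zero a i _))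
  apply Fin.ext
  split_ifs at h₄ <;> omega

/-- The indices of the cell run through `(0,0), …, (i,0), (i,1), …, (n,1)`. A simplex belongs to it
as soon as its level-0 part stays at or below `i` and its level-1 part at or above `i`. -/
theorem mem_range_prismCell {b : GDelta} (t : Fin (b.n + 1) →o Fin 2) (f : b ⟶ a)
    (h₀ : ∀ x, t x = 0 → (shape f x : ℕ) ≤ i) (h₁ : ∀ x, t x = 1 → (i : ℕ) ≤ shape f x) :
    ((t, f) : (Fin (b.n + 1) →o Fin 2) × (b ⟶ a)) ∈
      (Subfunctor.range (prismCell a i)).obj (op b) := by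
  have htwo : ∀ x, t x = 0 ∨ t x = 1 := fun x => by
    generalize t x = y
    fin_cases y <;> simp
  -- Position in the list of the cell: level-1 indices are shifted by one, since `i` occurs twice.
  let u : Fin (b.n + 1) → Fin (a.n + 2) := fun x =>
    if t x = 0 then (shape f x).castSucc else (shape f x).succ
  have hu₀ : ∀ x, t x = 0 → (u x : ℕ) = shape f x := fun x hx => by
    simp [u, hx]
  have hu₁ : ∀ x, t x = 1 → (u x : ℕ) = shape f x + 1 := fun x hx => by
    simp [u, hx]
  let χ : Fin (b.n + 1) →o Fin ((prismObj a i).n + 1) :=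
    { toFun := u
      monotone' := fun x y h => by
        have h' : (shape f x : ℕ) ≤ shape f y := (shape f).monotone h
        have ht := t.monotone h
        change (u x : ℕ) ≤ u y
        rcases htwo x with hx | hx <;> rcases htwo y with hy | hy
        · rw [hu₀ x hx, hu₀ y hy]; exact h'
        · rw [hu₀ x hx, hu₁ y hy]; omega
        · rw [hx, hy] at ht
          exact absurd ht (by decide)
        · rw [hu₁ x hx, hu₁ y hy]; omega }
  obtain ⟨f', hf', hf''⟩ := exists_lift (b := prismObj a i) f _ (shape_real (prismDegen a i)) χ
    (fun x => Fin.ext ((val_predAbove i (u x)).trans (by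
      rcases htwo x with h | h
      · rw [hu₀ x h, if_pos (h₀ x h)]
      · rw [hu₁ x h, if_neg (by have := h₁ x h; omega)]; rfl)))
  refine ⟨f', Prod.ext ?_ hf''⟩
  change (prismLevel a i).comp (shape f') = t
  rw [hf']
  ext1; funext x
  change prismLevel a i (u x) = t x
  rcases htwo x with h | h
  · rw [h, prismLevel_eq_zero, hu₀ x h]
    exact h₀ x h
  · rw [h, prismLevel_eq_one, hu₁ x h]
    have := h₁ x h
    omega

theorem level_of_mem_range_prismCell {b : GDelta} {t : Fin (b.n + 1) →o Fin 2} {f : b ⟶ a}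
    (h : ((t, f) : (Fin (b.n + 1) →o Fin 2) × (b ⟶ a)) ∈
      (Subfunctor.range (prismCell a i)).obj (op b)) (x : Fin (b.n + 1)) :
    (t x = 0 → (shape f x : ℕ) ≤ i) ∧ (t x = 1 → (i : ℕ) ≤ shape f x) := by
  obtain ⟨f', hf'⟩ := h
  change b ⟶ prismObj a i at f'
  rw [prismCell_app] at hf'
  obtain ⟨rfl, rfl⟩ := Prod.mk.inj hf'
  rw [val_shape_comp_prismDegen]
  constructor
  · intro h
    have := (prismLevel_eq_zero a i _).1 h
    split_ifs <;> omega
  · intro h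
    have := (prismLevel_eq_one a i _).1 h
    split_ifs <;> omega

/-- Both copies of `i` have the type of `i`, because `prismReal` gains one non-real index exactly
when `i` is non-real. Hence omitting either copy gives an admissible horn, with codegeneracy index
`i`. -/
theorem anodyneLLP_attach_prismCell {A A' : Subfunctor (interval ⊗ stdSimplex a)} (hA : A ≤ A')
    (hA' : A' = A ⊔ Subfunctor.range (prismCell a i)) (l : Fin (a.n + 2))
    (hl : (l : ℕ) = i ∨ (l : ℕ) = i + 1)
    (h : ∀ (b : GDelta) (f : b ⟶ prismObj a i), (((prismLevel a i).comp (shape f),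
      f ≫ prismDegen a i) : (Fin (b.n + 1) →o Fin 2) × (b ⟶ a)) ∈ A.obj (op b) ↔
        ∃ j, j ≠ l ∧ ∀ x, shape f x ≠ j) :
    anodyneLLP (Subfunctor.homOfLe hA) := by
  refine homOfLe_mem_of_attach hA (prismCell a i) hA'
    (fun b f g _ hfg => prismCell_injective b f g hfg) ?_
  have e : A.preimage (prismCell a i) = (prismHorn a i l).horn := by
    ext ⟨b⟩ f
    exact (h b f).trans (mem_horn (prismHorn a i l) f).symm
  rw [e]
  refine anodyneLLP_horn _ (isAdmissible_of_neighbour _ i ?_ ?_)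
  · change (i : ℕ) = l ∨ (i : ℕ) + 1 = l
    omega
  · change ((l : ℕ) < prismReal a i ∧ (i : ℕ) + 1 < prismReal a i) ∨
      (prismReal a i ≤ l ∧ prismReal a i ≤ i)
    unfold prismReal
    split_ifs <;> omega

/-- If a simplex of the cell misses an index `j`, its projection misses an index unless `j` is one
of the doubled ones. -/
theorem not_surjective_comp_prismDegen {b : GDelta} (f : b ⟶ prismObj a i) (j : Fin (a.n + 2))
    (hj : ∀ x, shape f x ≠ j) (h₀ : (j : ℕ) ≠ i) (h₁ : (j : ℕ) ≠ i + 1) :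
    ¬ Function.Surjective (shape (f ≫ prismDegen a i)) := by
  intro h
  have hj' : ∀ x, (shape f x : ℕ) ≠ j := fun x e => hj x (Fin.ext e)
  obtain ⟨x, hx⟩ := h (i.predAbove j)
  have hx' := congrArg Fin.val hx
  rw [val_shape_comp_prismDegen, val_predAbove] at hx'
  have := hj' x
  split_ifs at hx' <;> omega

/-- If the projection of a simplex of the cell misses an index, then the simplex misses the
corresponding ones. -/
theorem shape_ne_of_comp_prismDegen_ne {b : GDelta} (f : b ⟶ prismObj a i) (j : Fin (a.n + 1))
    (hj : ∀ x, shape (f ≫ prismDegen a i) x ≠ j) :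
    ((j : ℕ) ≤ i → ∀ x, shape f x ≠ j.castSucc) ∧ ((i : ℕ) ≤ j → ∀ x, shape f x ≠ j.succ) := by
  constructor
  · intro h x hx
    refine hj x (Fin.ext ?_)
    rw [val_shape_comp_prismDegen, hx]
    simp [h]
  · intro h x hx
    refine hj x (Fin.ext ?_)
    rw [val_shape_comp_prismDegen, hx]
    simp
    omega

/-- The filtration of the prism used for the end `1`. -/
def prismFiltrationOne (a : GDelta) (r : ℕ) : Subfunctor (interval ⊗ stdSimplex a) where
  obj b := {z : (Fin (b.unop.n + 1) →o Fin 2) × (b.unop ⟶ a) |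
    ¬ Function.Surjective (shape z.2) ∨ ∀ x, z.1 x = 0 → (shape z.2 x : ℕ) < r}
  map := by
    rintro b c g ⟨t, f⟩ (h | h)
    · exact Or.inl ((boundary a).map g h)
    · refine Or.inr fun x hx => ?_
      have := h _ hx
      rwa [← shape_comp] at this

/-- The filtration of the prism used for the end `0`. -/
def prismFiltrationZero (a : GDelta) (r : ℕ) : Subfunctor (interval ⊗ stdSimplex a) where
  obj b := {z : (Fin (b.unop.n + 1) →o Fin 2) × (b.unop ⟶ a) |
    ¬ Function.Surjective (shape z.2) ∨ ∀ x, z.1 x = 1 → a.n < (shape z.2 x : ℕ) + r}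
  map := by
    rintro b c g ⟨t, f⟩ (h | h)
    · exact Or.inl ((boundary a).map g h)
    · refine Or.inr fun x hx => ?_
      have := h _ hx
      rwa [← shape_comp] at this

theorem prismFiltrationOne_mono (a : GDelta) : Monotone (prismFiltrationOne a) :=
  fun _ _ h _ _ hz => hz.imp id fun hz x hx => (hz x hx).trans_le h

theorem prismFiltrationZero_mono (a : GDelta) : Monotone (prismFiltrationZero a) :=
  fun _ _ h _ _ hz => hz.imp id fun hz x hx => (hz x hx).trans_le (Nat.add_le_add_left h _)

theorem eq_zero_or_one (y : Fin 2) : y = 0 ∨ y = 1 := by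
  fin_cases y <;> simp

theorem prismFiltrationOne_succ (a : GDelta) (i : Fin (a.n + 1)) :
    prismFiltrationOne a (i + 1) = prismFiltrationOne a i ⊔ Subfunctor.range (prismCell a i) := by
  ext ⟨b⟩ ⟨t, f⟩
  change Fin (b.n + 1) →o Fin 2 at t
  change b ⟶ a at f
  constructor
  · intro h
    by_cases h' : ((t, f) : (Fin (b.n + 1) →o Fin 2) × (b ⟶ a)) ∈
        (prismFiltrationOne a i).obj (op b)
    · exact Or.inl h'
    · refine Or.inr ?_
      have h' := not_or.1 h'
      have h := h.resolve_left h'.1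
      change ∀ x, t x = 0 → (shape f x : ℕ) < i + 1 at h
      have h'' := h'.2
      push Not at h''
      obtain ⟨y, hy, hy'⟩ := h''
      change t y = 0 at hy
      change (i : ℕ) ≤ shape f y at hy'
      refine mem_range_prismCell t f (fun x hx => Nat.le_of_lt_succ (h x hx)) fun x hx => ?_
      refine hy'.trans ((shape f).monotone ?_)
      by_contra hlt
      have := t.monotone (not_le.1 hlt).le
      rw [hx, hy] at this
      exact absurd this (by decide)
  · rintro (h | h)
    · exact prismFiltrationOne_mono a (Nat.le_succ _) _ h
    · exact Or.inr fun x hx => Nat.lt_succ_of_le ((level_of_mem_range_prismCell h x).1 hx)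

theorem prismFiltrationZero_succ (a : GDelta) (i : Fin (a.n + 1)) (r : ℕ) (hr : i + r = a.n) :
    prismFiltrationZero a (r + 1) = prismFiltrationZero a r ⊔ Subfunctor.range (prismCell a i) := by
  ext ⟨b⟩ ⟨t, f⟩
  change Fin (b.n + 1) →o Fin 2 at t
  change b ⟶ a at f
  constructor
  · intro h
    by_cases h' : ((t, f) : (Fin (b.n + 1) →o Fin 2) × (b ⟶ a)) ∈
        (prismFiltrationZero a r).obj (op b)
    · exact Or.inl h'
    · refine Or.inr ?_
      have h' := not_or.1 h'
      have h := h.resolve_left h'.1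
      change ∀ x, t x = 1 → a.n < (shape f x : ℕ) + (r + 1) at h
      have h'' := h'.2
      push Not at h''
      obtain ⟨y, hy, hy'⟩ := h''
      change t y = 1 at hy
      change (shape f y : ℕ) + r ≤ a.n at hy'
      refine mem_range_prismCell t f (fun x hx => ?_) fun x hx => by have := h x hx; omega
      refine le_trans ((shape f).monotone (?_ : x ≤ y)) (by omega)
      by_contra hlt
      have := t.monotone (not_le.1 hlt).le
      rw [hx, hy] at this
      exact absurd this (by decide)
  · rintro (h | h)
    · exact prismFiltrationZero_mono a (Nat.le_succ _) _ h
    · refine Or.inr fun x hx => ?_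
      have := (level_of_mem_range_prismCell h x).2 hx
      change a.n < (shape f x : ℕ) + (r + 1)
      omega

/-- The face of the cell without `i` lies in the preceding cell, or in the end `1` if `i = 0`; faces
without an index other than `i` and `i + 1` project to the boundary. Only the face without `i + 1`
is new, so the horn at `i + 1` is filled. -/
theorem prismFiltrationOne_step (a : GDelta) (i : Fin (a.n + 1)) :
    anodyneLLP (Subfunctor.homOfLe (prismFiltrationOne_mono a (Nat.le_succ i))) := by
  refine anodyneLLP_attach_prismCell _ (prismFiltrationOne_succ a i) i.succ (Or.inr rfl) ?_
  intro b f
  constructor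
  · rintro (h | h)
    · obtain ⟨j, hj⟩ := not_forall.1 h
      have hj' := shape_ne_of_comp_prismDegen_ne f j (fun x hx => hj ⟨x, hx⟩)
      by_cases hji : (j : ℕ) ≤ i
      · exact ⟨j.castSucc, fun e => by
          have := congrArg Fin.val e
          simp at this
          omega, hj'.1 hji⟩
      · exact ⟨j.succ, fun e => by
          have := congrArg Fin.val e
          simp at this
          omega, hj'.2 (by omega)⟩
    · refine ⟨i.castSucc, fun e => by simpa using congrArg Fin.val e, fun x hx => ?_⟩
      have hx' : (shape f x : ℕ) = i := congrArg Fin.val hx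
      have := h x ((prismLevel_eq_zero a i _).2 hx'.le)
      change (shape (f ≫ prismDegen a i) x : ℕ) < i at this
      rw [val_shape_comp_prismDegen, if_pos hx'.le] at this
      omega
  · rintro ⟨j, hjl, hj⟩
    have hjl' : (j : ℕ) ≠ i + 1 := fun e => hjl (Fin.ext e)
    by_cases hji : (j : ℕ) = i
    · refine Or.inr fun x hx => ?_
      have hx' := (prismLevel_eq_zero a i _).1 hx
      have hx'' : (shape f x : ℕ) ≠ j := fun e => hj x (Fin.ext e)
      change (shape (f ≫ prismDegen a i) x : ℕ) < i
      rw [val_shape_comp_prismDegen]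
      split_ifs <;> omega
    · exact Or.inl (not_surjective_comp_prismDegen f j hj hji hjl')

/-- The mirror image: cells are attached from `i = n` downwards, stage `r` adding the cell `n - r`.
Now the face without `i + 1` is already present and the horn at `i` is filled. -/
theorem prismFiltrationZero_step (a : GDelta) (i : Fin (a.n + 1)) (r : ℕ) (hr : i + r = a.n) :
    anodyneLLP (Subfunctor.homOfLe (prismFiltrationZero_mono a (Nat.le_succ r))) := by
  refine anodyneLLP_attach_prismCell _ (prismFiltrationZero_succ a i r hr) i.castSucc
    (Or.inl rfl) ?_
  intro b f
  constructor
  · rintro (h | h)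
    · obtain ⟨j, hj⟩ := not_forall.1 h
      have hj' := shape_ne_of_comp_prismDegen_ne f j (fun x hx => hj ⟨x, hx⟩)
      by_cases hji : (j : ℕ) < i
      · exact ⟨j.castSucc, fun e => by
          have := congrArg Fin.val e
          simp at this
          omega, hj'.1 hji.le⟩
      · exact ⟨j.succ, fun e => by
          have := congrArg Fin.val e
          simp at this
          omega, hj'.2 (by omega)⟩
    · refine ⟨i.succ, fun e => by simpa using congrArg Fin.val e, fun x hx => ?_⟩
      have hx' : (shape f x : ℕ) = i + 1 := congrArg Fin.val hx
      have := h x ((prismLevel_eq_one a i _).2 (by omega))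
      change a.n < (shape (f ≫ prismDegen a i) x : ℕ) + r at this
      rw [val_shape_comp_prismDegen, if_neg (by omega)] at this
      omega
  · rintro ⟨j, hjl, hj⟩
    have hjl' : (j : ℕ) ≠ i := fun e => hjl (Fin.ext e)
    by_cases hji : (j : ℕ) = i + 1
    · refine Or.inr fun x hx => ?_
      have hx' := (prismLevel_eq_one a i _).1 hx
      have hx'' : (shape f x : ℕ) ≠ j := fun e => hj x (Fin.ext e)
      change a.n < (shape (f ≫ prismDegen a i) x : ℕ) + r
      rw [val_shape_comp_prismDegen, if_neg (by omega)]
      omega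
    · exact Or.inl (not_surjective_comp_prismDegen f j hj hjl' hji)

theorem anodyneLLP_of_filtration {Z : SSetIsov} {F : ℕ → Subfunctor Z} (hF : Monotone F) (n : ℕ)
    (h : ∀ r < n, anodyneLLP (Subfunctor.homOfLe (hF (Nat.le_succ r)))) (hn : F n = ⊤) :
    anodyneLLP (F 0).ι := by
  have key : ∀ r (_ : r ≤ n), anodyneLLP (Subfunctor.homOfLe (hF (Nat.zero_le r))) := by
    intro r
    induction r with
    | zero => exact fun _ => anodyneLLP.id_mem (F 0).toFunctor
    | succ r ih => exact fun hr => MorphismProperty.comp_mem _ _ _ (ih (by omega)) (h r (by omega))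
  have h₁ := key n le_rfl
  have : IsIso (F n).ι := by
    rw [← Subfunctor.eq_top_iff_isIso]
    exact hn
  exact anodyneLLP.comp_mem _ _ h₁ (anodyneLLP.of_isIso (F n).ι)

/-- The prism over a boundary, relative to one end, is anodyne. -/
theorem anodyneLLP_prism (a : GDelta) (ε : Fin 2) :
    anodyneLLP (unionProd (intervalEnd ε) (boundary a)).ι := by
  rcases eq_zero_or_one ε with rfl | rfl
  · have e : unionProd (intervalEnd 0) (boundary a) = prismFiltrationZero a 0 := by
      ext ⟨b⟩ ⟨t, f⟩
      change Fin (b.n + 1) →o Fin 2 at t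
      change b ⟶ a at f
      change ((∀ x, t x = 0) ∨ ¬ Function.Surjective (shape f)) ↔
        (¬ Function.Surjective (shape f) ∨ ∀ x, t x = 1 → a.n < (shape f x : ℕ) + 0)
      rw [or_comm]
      refine or_congr Iff.rfl (forall_congr' fun x => ?_)
      have := (shape f x).2
      rcases eq_zero_or_one (t x) with h | h <;> rw [h] <;> (simp; try omega)
    rw [e]
    refine anodyneLLP_of_filtration (prismFiltrationZero_mono a) (a.n + 1) (fun r hr =>
      prismFiltrationZero_step a ⟨a.n - r, by omega⟩ r (by dsimp only; omega)) ?_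
    ext ⟨b⟩ ⟨t, f⟩
    refine ⟨fun _ => trivial, fun _ => Or.inr fun x _ => ?_⟩
    omega
  · have e : unionProd (intervalEnd 1) (boundary a) = prismFiltrationOne a 0 := by
      ext ⟨b⟩ ⟨t, f⟩
      change Fin (b.n + 1) →o Fin 2 at t
      change b ⟶ a at f
      change ((∀ x, t x = 1) ∨ ¬ Function.Surjective (shape f)) ↔
        (¬ Function.Surjective (shape f) ∨ ∀ x, t x = 0 → (shape f x : ℕ) < 0)
      rw [or_comm]
      refine or_congr Iff.rfl (forall_congr' fun x => ?_)
      rcases eq_zero_or_one (t x) with h | h <;> rw [h] <;> simp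
    rw [e]
    refine anodyneLLP_of_filtration (prismFiltrationOne_mono a) (a.n + 1) (fun r hr =>
      prismFiltrationOne_step a ⟨r, hr⟩) ?_
    ext ⟨b⟩ ⟨t, f⟩
    exact ⟨fun _ => trivial, fun _ => Or.inr fun x _ => Fin.is_lt _⟩

/-- The prism over an inclusion into a free object, relative to one end, is anodyne. -/
theorem anodyneLLP_unionProd_end {L : SSetIsov} (hL : IsFree L) (K : Subfunctor L) (ε : Fin 2) :
    anodyneLLP (unionProd (intervalEnd ε) K).ι :=
  unionProd_mem_llp (intervalEnd ε) boundary (fun a => anodyneLLP_prism a ε) K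
    (boundaryInclusions_rlp_llp_ι hL K)

end Prism
end Isov

namespace Isov

open GDelta

/-! ### Maps into thickenings -/

/-- A level and a map to `A` give a map to the thickening of `A`. -/
def thickPairHom {b : GDelta} {A : FinGPoset} (t : Fin (b.n + 1) →o Fin 2)
    (f : FinGPoset.Hom b.toFinGPoset A) : FinGPoset.Hom b.toFinGPoset (FinGPoset.thick A) where
  toFun x := ⟨f.toFun x, t (index x)⟩
  monotone h := ⟨f.monotone h, t.monotone (Vertex.idx_mono h)⟩
  equivariant g x := FinGPoset.Thick.ext' (f.equivariant g x) (congrArg t (Vertex.idx_smul g x))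
  isotropy x := (f.isotropy x).trans
    (FinGPoset.Thick.stabilizer_eq (A := A) ⟨f.toFun x, t (index x)⟩).symm

/-- Pairs of levels and simplices as maps to the thickening. -/
def thickPair (a : GDelta) : interval ⊗ stdSimplex a ⟶ simplexCylinder.obj a where
  app b := ↾fun (z : (Fin (b.unop.n + 1) →o Fin 2) × (b.unop ⟶ a)) =>
    (show b.unop.toFinGPoset ⟶ FinGPoset.thick a.toFinGPoset from thickPairHom z.1 z.2)
  naturality b c g := by
    ext ⟨t, f⟩
    change Fin (b.unop.n + 1) →o Fin 2 at t
    refine FinGPoset.Hom.ext (funext fun x => FinGPoset.Thick.ext' rfl ?_)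
    exact congrArg t (index_toFun g.unop x).symm

/-! ### Contractions of simplices onto horns -/

/-- A family of maps of indices as an isovariant map on the thickening. -/
def thickHom {a : GDelta} (ρ : Fin 2 →o (Fin (a.n + 1) →o Fin (a.n + 1)))
    (hρ : ∀ s (j : Fin (a.n + 1)), a.k ≤ (j : ℕ) ↔ a.k ≤ (ρ s j : ℕ)) :
    FinGPoset.Hom (FinGPoset.thick a.toFinGPoset) a.toFinGPoset where
  toFun x := (asHom (homOfOrderHom (ρ x.level) (hρ x.level))).toFun x.pt
  monotone {x y} h := by
    refine le_trans ((asHom (homOfOrderHom (ρ x.level) (hρ x.level))).monotone h.1) ?_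
    obtain ⟨⟨x, s⟩, ⟨y, t⟩⟩ := x, y
    induction y using Vertex.ind with | h j g =>
    exact Vertex.mk_le_mk.2 ⟨ρ.monotone h.2 j, Or.inl rfl⟩
  equivariant g x := (asHom (homOfOrderHom (ρ x.level) (hρ x.level))).equivariant g x.pt
  isotropy x := (FinGPoset.Thick.stabilizer_eq x).trans
    ((asHom (homOfOrderHom (ρ x.level) (hρ x.level))).isotropy x.pt)

/-- The deformation of a simplex given by a family of maps of indices. -/
def deformation {a : GDelta} (ρ : Fin 2 →o (Fin (a.n + 1) →o Fin (a.n + 1)))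
    (hρ : ∀ s (j : Fin (a.n + 1)), a.k ≤ (j : ℕ) ↔ a.k ≤ (ρ s j : ℕ)) :
    interval ⊗ stdSimplex a ⟶ stdSimplex a :=
  thickPair a ≫ nerve.map (show FinGPoset.thick a.toFinGPoset ⟶ a.toFinGPoset from thickHom ρ hρ)

theorem shape_deformation {a b : GDelta} (ρ : Fin 2 →o (Fin (a.n + 1) →o Fin (a.n + 1)))
    (hρ : ∀ s (j : Fin (a.n + 1)), a.k ≤ (j : ℕ) ↔ a.k ≤ (ρ s j : ℕ))
    (t : Fin (b.n + 1) →o Fin 2) (f : b ⟶ a) (x : Fin (b.n + 1)) :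
    shape (show b ⟶ a from (deformation ρ hρ).app (op b)
      ((t, f) : (Fin (b.n + 1) →o Fin 2) × (b ⟶ a))) x = ρ (t x) (shape f x) :=
  index_toFun (homOfOrderHom (ρ (t x)) (hρ (t x))) ((asHom f).toFun (b.vertex x 1))

theorem deformation_eq_self {a b : GDelta} (ρ : Fin 2 →o (Fin (a.n + 1) →o Fin (a.n + 1)))
    (hρ : ∀ s (j : Fin (a.n + 1)), a.k ≤ (j : ℕ) ↔ a.k ≤ (ρ s j : ℕ))
    (t : Fin (b.n + 1) →o Fin 2) (f : b ⟶ a) (h : ∀ x, ρ (t x) = OrderHom.id) :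
    (deformation ρ hρ).app (op b) ((t, f) : (Fin (b.n + 1) →o Fin 2) × (b ⟶ a)) = f := by
  refine hom_ext fun x => ?_
  change (asHom (homOfOrderHom (ρ (t x)) (hρ (t x)))).toFun ((asHom f).toFun (b.vertex x 1)) = _
  generalize (asHom f).toFun (b.vertex x 1) = y
  induction y using Vertex.ind with | h j g =>
  change Vertex.mk (ρ (t x) j) g = _
  rw [h x]
  rfl

/-- If a deformation pushes a simplex into a horn, the pushout-product of the horn with the boundary
of the interval is anodyne. -/
theorem anodyneLLP_unionProd_bdry_horn_of_deformation (p : HornIndex) (ε ε' : Fin 2)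
    (ρ : Fin 2 →o (Fin (p.top.n + 1) →o Fin (p.top.n + 1)))
    (hρ : ∀ s (j : Fin (p.top.n + 1)), p.top.k ≤ (j : ℕ) ↔ p.top.k ≤ (ρ s j : ℕ))
    (h₁ : ρ ε' = OrderHom.id) (h₂ : ∃ j, j ≠ p.l ∧ ∀ i, ρ ε i ≠ j)
    (h₃ : ∀ s i, ρ s i ≠ p.l → ρ s i = i) :
    anodyneLLP (unionProd intervalBdry p.horn).ι := by
  -- The retraction `r` applies the deformation to the simplex and keeps the inner level; `e` enters
  -- at the outer level `ε'`, where the deformation is the identity.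
  let e : interval ⊗ stdSimplex p.top ⟶ interval :=
    { app := fun b => ↾fun _ => (OrderHom.const _ ε' : Fin (b.unop.n + 1) →o Fin 2) }
  let r : interval ⊗ (interval ⊗ stdSimplex p.top) ⟶ interval ⊗ stdSimplex p.top :=
    CartesianMonoidalCategory.lift
      (CartesianMonoidalCategory.snd _ _ ≫ CartesianMonoidalCategory.fst _ _)
      (CartesianMonoidalCategory.lift (CartesianMonoidalCategory.fst _ _)
        (CartesianMonoidalCategory.snd _ _ ≫ CartesianMonoidalCategory.snd _ _) ≫
          deformation ρ hρ)
  refine MorphismProperty.of_retract (retractUnionProd (intervalEnd ε) _ e r ?_ ?_)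
    (anodyneLLP_unionProd_end
      (IsFree.of_hom (CartesianMonoidalCategory.snd _ _) (isFree_stdSimplex p.top)) _ ε)
  · rintro ⟨b⟩ ⟨s, f⟩
    exact congrArg (Prod.mk s) (deformation_eq_self ρ hρ (OrderHom.const _ ε') f fun _ => h₁)
  · rintro ⟨b⟩ ⟨t, s, f⟩ h
    change Fin (b.n + 1) →o Fin 2 at t
    change b ⟶ p.top at f
    -- At the outer end `ε` the simplex is pushed into the horn. An inner level in the boundary is
    -- left unchanged. A simplex of the horn stays there, since an index other than `l` can only be
    -- hit from itself.
    rcases h with h | h | h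
    · refine Or.inr ((mem_horn p _).2 ?_)
      obtain ⟨j, hj, hj'⟩ := h₂
      refine ⟨j, hj, fun x hx => hj' (shape f x) ?_⟩
      refine Eq.trans ?_ ((shape_deformation ρ hρ t f x).symm.trans hx)
      rw [show t x = ε from h x]
    · exact Or.inl h
    · refine Or.inr ((mem_horn p _).2 ?_)
      obtain ⟨j, hj, hj'⟩ := (mem_horn p f).1 h
      refine ⟨j, hj, fun x hx => hj' x ?_⟩
      have hx' := (shape_deformation ρ hρ t f x).symm.trans hx
      exact (h₃ _ _ (hx'.trans_ne hj)).symm.trans hx'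

/-- The map of indices collapsing `q` to the neighbouring index `l`. -/
def collapse {n : ℕ} (q l : Fin (n + 1)) (h : (q : ℕ) + 1 = l ∨ (l : ℕ) + 1 = q) :
    Fin (n + 1) →o Fin (n + 1) where
  toFun i := if i = q then l else i
  monotone' i j hij := by
    have hij' : (i : ℕ) ≤ j := hij
    dsimp only
    split_ifs with hi hj hj <;> simp only [Fin.ext_iff] at * <;>
      first | exact le_rfl | (apply Fin.le_def.2; omega)

/-- Admissibility provides a neighbour `q` of `l` of the same type. Collapsing `q` to `l` respects
types, misses `q`, and is comparable with the identity: above it if `q < l`, below it if `q > l`.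
This decides which end of the interval carries the identity. -/
theorem anodyneLLP_unionProd_bdry_horn (p : HornIndex) (hp : p.IsAdmissible) :
    anodyneLLP (unionProd intervalBdry p.horn).ι := by
  have hq : ∃ q : Fin (p.m + 2), ((q : ℕ) + 1 = p.l ∨ (p.l : ℕ) + 1 = q) ∧
      (p.k ≤ (q : ℕ) ↔ p.k ≤ (p.l : ℕ)) := by
    obtain ⟨a, ha, h⟩ := hp
    have hcol : ((p.l : ℕ) < p.k ∧ (a : ℕ) + 1 < p.k) ∨ (p.k ≤ (p.l : ℕ) ∧ p.k ≤ (a : ℕ)) :=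
      h.imp (fun ⟨h, h', _⟩ => ⟨h, h'⟩) (fun ⟨h, h', _⟩ => ⟨h, h'⟩)
    rcases ha with ha | ha
    · exact ⟨a.succ, Or.inr (by simp [ha]), by simp only [Fin.val_succ]; omega⟩
    · exact ⟨a.castSucc, Or.inl (by simp [ha]), by simp only [Fin.val_castSucc]; omega⟩
  obtain ⟨q, hql, hcol⟩ := hq
  have hne : q ≠ p.l := fun e => by rw [e] at hql; omega
  let c := collapse q p.l hql
  have hc : ∀ i, c i = if i = q then p.l else i := fun _ => rfl
  have hcol' : ∀ j : Fin (p.m + 2), p.k ≤ (j : ℕ) ↔ p.k ≤ (c j : ℕ) := fun j => by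
    rw [hc]
    split_ifs with h
    · rw [h, hcol]
    · rfl
  have hc' : ∀ i, c i ≠ p.l → c i = i := fun i => by
    rw [hc]
    split_ifs with h
    · exact fun h => absurd rfl h
    · exact fun _ => rfl
  have hcq : ∀ i, c i ≠ q := fun i => by
    rw [hc]
    split_ifs with h
    · exact hne.symm
    · exact h
  rcases hql with hql | hql
  · let ρ : Fin 2 →o (Fin (p.m + 2) →o Fin (p.m + 2)) :=
      { toFun := fun s => if s = 0 then OrderHom.id else c
        monotone' := fun s s' h => by
          rcases eq_zero_or_one s with rfl | rfl <;> rcases eq_zero_or_one s' with rfl | rfl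
          · exact le_rfl
          · intro i
            change (i : ℕ) ≤ c i
            rw [hc]
            split_ifs with h
            · rw [h]; omega
            · exact le_rfl
          · exact absurd h (by decide)
          · exact le_rfl }
    refine anodyneLLP_unionProd_bdry_horn_of_deformation p 1 0 ρ ?_ rfl ⟨q, hne, hcq⟩ ?_
    · intro s j
      rcases eq_zero_or_one s with rfl | rfl
      · exact Iff.rfl
      · exact hcol' j
    · intro s i
      rcases eq_zero_or_one s with rfl | rfl
      · exact fun _ => rfl
      · exact hc' i
  · let ρ : Fin 2 →o (Fin (p.m + 2) →o Fin (p.m + 2)) :=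
      { toFun := fun s => if s = 0 then c else OrderHom.id
        monotone' := fun s s' h => by
          rcases eq_zero_or_one s with rfl | rfl <;> rcases eq_zero_or_one s' with rfl | rfl
          · exact le_rfl
          · intro i
            change (c i : ℕ) ≤ i
            rw [hc]
            split_ifs with h
            · rw [h]; omega
            · exact le_rfl
          · exact absurd h (by decide)
          · exact le_rfl }
    refine anodyneLLP_unionProd_bdry_horn_of_deformation p 0 1 ρ ?_ rfl ⟨q, hne, hcq⟩ ?_
    · intro s j
      rcases eq_zero_or_one s with rfl | rfl
      · exact hcol' j
      · exact Iff.rfl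
    · intro s i
      rcases eq_zero_or_one s with rfl | rfl
      · exact hc' i
      · exact fun _ => rfl

theorem anodyneLLP_unionProd_bdry {L : SSetIsov} (M : Subfunctor L) (hM : anodyneLLP M.ι) :
    anodyneLLP (unionProd intervalBdry M).ι :=
  unionProd_mem_llp intervalBdry
    (fun p : {p : HornIndex // p.IsAdmissible} => p.1.horn)
    (fun p => anodyneLLP_unionProd_bdry_horn p.1 p.2) M hM

end Isov

namespace Isov

open GDelta

/-! ### The cylinder as a product with the interval -/

/-- The level of a map to a thickening. -/
def thickLevel {b : GDelta} {A : FinGPoset}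
    (f : FinGPoset.Hom b.toFinGPoset (FinGPoset.thick A)) : Fin (b.n + 1) →o Fin 2 where
  toFun i := (f.toFun (b.vertex i 1)).level
  monotone' _ _ h := (f.monotone (Vertex.mk_le_mk.2 ⟨h, Or.inl rfl⟩)).2

theorem thickLevel_index {b : GDelta} {A : FinGPoset}
    (f : FinGPoset.Hom b.toFinGPoset (FinGPoset.thick A)) (x : b.toFinGPoset.carrier) :
    thickLevel f (index x) = (f.toFun x).level := by
  obtain ⟨u, hu⟩ := Vertex.eq_smul_mk_one (n := b.n) (k := b.k) x
  have hx : x = u • b.vertex (index x) 1 := hu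
  conv_rhs => rw [hx, f.equivariant]
  rfl

theorem thickPair_bijective (a : GDelta) (b : GDeltaᵒᵖ) :
    Function.Bijective ((thickPair a).app b) := by
  constructor
  · rintro ⟨t, f⟩ ⟨t', f'⟩ h
    have h' : ∀ x, (thickPairHom (b := b.unop) t f).toFun x = (thickPairHom t' f').toFun x :=
      fun x => congrArg (fun q : FinGPoset.Hom _ _ => q.toFun x) h
    refine Prod.ext (OrderHom.ext _ _ (funext fun i => ?_)) (FinGPoset.Hom.ext (funext fun x => ?_))
    · exact congrArg FinGPoset.Thick.level (h' (b.unop.vertex i 1))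
    · exact congrArg FinGPoset.Thick.pt (h' x)
  · intro q
    refine ⟨((thickLevel q, show b.unop ⟶ a from ((simplexProj.app a).app b q)) :
      (Fin (b.unop.n + 1) →o Fin 2) × (b.unop ⟶ a)), ?_⟩
    exact FinGPoset.Hom.ext (funext fun x =>
      FinGPoset.Thick.ext' rfl (thickLevel_index q x))

/-- The cylinder of a standard simplex is its product with the interval. -/
noncomputable def simplexCylinderIso :
    (yoneda : GDelta ⥤ SSetIsov) ⋙ MonoidalCategory.tensorLeft interval ≅ simplexCylinder :=
  NatIso.ofComponents
    (fun a =>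
      have : IsIso (thickPair a) := by
        rw [NatTrans.isIso_iff_isIso_app]
        exact fun b => (isIso_iff_bijective _).2 (thickPair_bijective a b)
      asIso (thickPair a))
    (fun _ => rfl)

/-- The unit of `X ↦ interval ⊗ X` as a left Kan extension along the Yoneda embedding. -/
abbrev tensorIntervalUnit :
    (yoneda : GDelta ⥤ SSetIsov) ⋙ MonoidalCategory.tensorLeft interval ⟶
    yoneda ⋙ 𝟭 SSetIsov ⋙ MonoidalCategory.tensorLeft interval :=
  Functor.whiskerRight (Functor.rightUnitor (yoneda : GDelta ⥤ SSetIsov)).inv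
    (MonoidalCategory.tensorLeft interval) ≫ (Functor.associator _ _ _).hom

/-- The cylinder of an isovariant simplicial set is its product with the interval. -/
noncomputable def cylinderIso :
    cylinderFunctor ≅ 𝟭 SSetIsov ⋙ MonoidalCategory.tensorLeft interval :=
  -- Tensoring with the interval preserves colimits, so it preserves the Kan extension that exhibits
  -- the identity functor; uniqueness then gives the isomorphism.
  Functor.leftKanExtensionUniqueOfIso cylinderFunctor cylinderUnit simplexCylinderIso.symm
    (𝟭 SSetIsov ⋙ MonoidalCategory.tensorLeft interval) tensorIntervalUnit

/-- The inclusion of the end `ε` of the cylinder. -/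
def intervalEndIncl (ε : Fin 2) :
    𝟭 SSetIsov ⟶ 𝟭 SSetIsov ⋙ MonoidalCategory.tensorLeft interval where
  app X :=
    { app := fun b => ↾fun x => (((OrderHom.const _ ε : Fin (b.unop.n + 1) →o Fin 2), x) :
        (Fin (b.unop.n + 1) →o Fin 2) × X.obj b) }

theorem simplexEnd_eq (ε : Fin 2) : simplexEnd ε =
    (show (yoneda : GDelta ⥤ SSetIsov) ⟶ yoneda ⋙ MonoidalCategory.tensorLeft interval from
      Functor.whiskerLeft yoneda (intervalEndIncl ε)) ≫ simplexCylinderIso.hom := rfl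

theorem cylinderUnit_cylinderIso :
    cylinderUnit ≫ Functor.whiskerLeft yoneda cylinderIso.hom =
      simplexCylinderIso.inv ≫ tensorIntervalUnit :=
  Functor.descOfIsLeftKanExtension_fac _ _ _ _

/-- Both sides are transformations out of the identity functor, a left Kan extension of the Yoneda
embedding along itself, so representables suffice. -/
theorem desc_simplexEnd_cylinderIso (ε : Fin 2) :
    ((𝟭 SSetIsov).descOfIsLeftKanExtension (Functor.rightUnitor (yoneda : GDelta ⥤ SSetIsov)).inv
      cylinderFunctor (simplexEnd ε ≫ cylinderUnit)) ≫ cylinderIso.hom = intervalEndIncl ε := by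
  apply Functor.hom_ext_of_isLeftKanExtension _
    (Functor.rightUnitor (yoneda : GDelta ⥤ SSetIsov)).inv
  rw [Functor.whiskerLeft_comp, Functor.descOfIsLeftKanExtension_fac_assoc, Category.assoc,
    cylinderUnit_cylinderIso, simplexEnd_eq, Category.assoc, Iso.hom_inv_id_assoc]
  rfl

/-! ### Comparison of the canonical maps with inclusions of subobjects -/

variable {K L : SSetIsov}

/-- The cylinder of `X` is the product with the interval. -/
noncomputable def cylinderObjIso (X : SSetIsov) : cylinder.I.obj X ≅ interval ⊗ X :=
  cylinderIso.app X

theorem δ_cylinderObjIso (ε : Fin 2) (X : SSetIsov) :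
    (cylinder.δ ε).app X ≫ (cylinderObjIso X).hom = (intervalEndIncl ε).app X :=
  NatTrans.congr_app (desc_simplexEnd_cylinderIso ε) X

theorem map_cylinderObjIso (f : K ⟶ L) :
    cylinder.I.map f ≫ (cylinderObjIso L).hom =
      (cylinderObjIso K).hom ≫ MonoidalCategory.whiskerLeft interval f :=
  cylinderIso.hom.naturality f

theorem mono_app_injective (f : K ⟶ L) [Mono f] (a : GDeltaᵒᵖ) : Function.Injective (f.app a) :=
  (mono_iff_injective _).1 inferInstance

/-- The inclusion of `I K` into the union. -/
def unionProdCyl (A : Subfunctor interval) (f : K ⟶ L) :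
    interval ⊗ K ⟶ (unionProd A (Subfunctor.range f)).toFunctor :=
  Subfunctor.lift (MonoidalCategory.whiskerLeft interval f) (by
    rintro a _ ⟨⟨t, x⟩, rfl⟩
    exact Or.inr ⟨x, rfl⟩)

theorem unionProdCyl_injective (A : Subfunctor interval) (f : K ⟶ L) [Mono f] (a : GDeltaᵒᵖ) :
    Function.Injective ((unionProdCyl A f).app a) := by
  rintro ⟨t, x⟩ ⟨t', x'⟩ h
  obtain ⟨rfl, h'⟩ := Prod.mk.inj (congrArg Subtype.val h)
  exact congrArg (Prod.mk t) (mono_app_injective f a h')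

/-- A map out of a pushout computing a union in `interval ⊗ L` is isomorphic to the inclusion. -/
theorem mem_of_isPushout {W : MorphismProperty SSetIsov} [W.RespectsIso]
    {A : Subfunctor interval} {f : K ⟶ L} (hW : W (unionProd A (Subfunctor.range f)).ι)
    {D E P : SSetIsov} {d : D ⟶ cylinder.I.obj K} {g : D ⟶ E} {i : cylinder.I.obj K ⟶ P}
    {j : E ⟶ P} (sq : IsPushout d g i j)
    {k : E ⟶ (unionProd A (Subfunctor.range f)).toFunctor}
    (sq' : IsPushout (d ≫ (cylinderObjIso K).hom) g (unionProdCyl A f) k)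
    (φ : P ⟶ cylinder.I.obj L) (h₁ : i ≫ φ = cylinder.I.map f)
    (h₂ : j ≫ φ ≫ (cylinderObjIso L).hom = k ≫ (unionProd A (Subfunctor.range f)).ι) : W φ := by
  have sq'' : IsPushout d g ((cylinderObjIso K).hom ≫ unionProdCyl A f) k :=
    sq'.of_iso (Iso.refl _) (cylinderObjIso K).symm (Iso.refl _) (Iso.refl _)
      (by simp) (by simp) (by simp) (by simp)
  refine (W.arrow_mk_iso_iff (Arrow.isoMk (sq.isoIsPushout _ _ sq'') (cylinderObjIso L) ?_)).2 hW
  refine sq.hom_ext ?_ ?_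
  · refine (IsPushout.inl_isoIsPushout_hom_assoc _ _ sq sq'' _).trans ?_
    exact (map_cylinderObjIso f).symm.trans (by rw [← h₁, Category.assoc]; rfl)
  · exact (IsPushout.inr_isoIsPushout_hom_assoc _ _ sq sq'' _).trans h₂.symm

/-- The map `I K ∪ {ε} L → I L`, for any pushout, is isomorphic to an inclusion. -/
theorem mem_of_isPushout_end {W : MorphismProperty SSetIsov} [W.RespectsIso] {ε : Fin 2}
    {f : K ⟶ L} [Mono f] (hW : W (unionProd (intervalEnd ε) (Subfunctor.range f)).ι)
    {P : SSetIsov} {i : cylinder.I.obj K ⟶ P} {j : L ⟶ P}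
    (sq : IsPushout ((cylinder.δ ε).app K) f i j) (φ : P ⟶ cylinder.I.obj L)
    (h₁ : i ≫ φ = cylinder.I.map f) (h₂ : j ≫ φ = (cylinder.δ ε).app L) : W φ := by
  let k : L ⟶ (unionProd (intervalEnd ε) (Subfunctor.range f)).toFunctor :=
    Subfunctor.lift ((intervalEndIncl ε).app L) (by
      rintro a _ ⟨x, rfl⟩
      exact Or.inl fun _ => rfl)
  refine mem_of_isPushout hW sq (k := k) ?_ φ h₁ ?_
  · rw [δ_cylinderObjIso]
    refine isPushout_of_elementwise rfl (unionProdCyl_injective _ f) ?_ ?_ ?_ ?_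
    · intro a x y _ h
      exact mono_app_injective f a h
    · rintro a ⟨⟨t, x⟩, h | ⟨y, hy⟩⟩
      · refine Or.inr ⟨x, Subtype.ext (Prod.ext ?_ rfl)⟩
        exact OrderHom.ext _ _ (funext fun s => (h s).symm)
      · exact Or.inl ⟨(t, y), Subtype.ext (congrArg (Prod.mk t) hy)⟩
    · rintro a ⟨t, x⟩ y h
      exact ⟨x, (Prod.mk.inj (congrArg Subtype.val h)).2⟩
    · rintro a x y - - h
      exact (Prod.mk.inj (congrArg Subtype.val h)).2
  · rw [reassoc_of% h₂, δ_cylinderObjIso]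
    rfl

theorem jointly_surjective_of_isColimit_binaryCofan {X Y Z : SSetIsov} {u : X ⟶ Z} {v : Y ⟶ Z}
    (h : IsColimit (BinaryCofan.mk u v)) (a : GDeltaᵒᵖ) (z : Z.obj a) :
    (∃ x, u.app a x = z) ∨ ∃ y, v.app a y = z := by
  obtain ⟨⟨j⟩, x, hx⟩ := Types.jointly_surjective_of_isColimit
    (isColimitOfPreserves ((evaluation _ _).obj a) h) z
  cases j
  · exact Or.inl ⟨x, hx⟩
  · exact Or.inr ⟨x, hx⟩

/-- The map `I K ∪ ∂I(L) → I L`, for any pushout, is isomorphic to an inclusion. -/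
theorem mem_of_isPushout_bdry {W : MorphismProperty SSetIsov} [W.RespectsIso]
    {f : K ⟶ L} [Mono f] (hW : W (unionProd intervalBdry (Subfunctor.range f)).ι)
    {D E P : SSetIsov} {u : Fin 2 → (K ⟶ D)} {v : Fin 2 → (L ⟶ E)}
    (hu : IsColimit (BinaryCofan.mk (u 0) (u 1))) (hv : IsColimit (BinaryCofan.mk (v 0) (v 1)))
    {d : D ⟶ cylinder.I.obj K} (hd : ∀ ε, u ε ≫ d = (cylinder.δ ε).app K)
    {e : E ⟶ cylinder.I.obj L} (he : ∀ ε, v ε ≫ e = (cylinder.δ ε).app L)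
    {g : D ⟶ E} (hg : ∀ ε, u ε ≫ g = f ≫ v ε)
    {i : cylinder.I.obj K ⟶ P} {j : E ⟶ P} (sq : IsPushout d g i j) (φ : P ⟶ cylinder.I.obj L)
    (h₁ : i ≫ φ = cylinder.I.map f) (h₂ : j ≫ φ = e) : W φ := by
  have hu' : ∀ a (z : D.obj a), ∃ ε x, (u ε).app a x = z := fun a z =>
    (jointly_surjective_of_isColimit_binaryCofan hu a z).elim (fun h => ⟨0, h⟩) (fun h => ⟨1, h⟩)
  have hv' : ∀ a (z : E.obj a), ∃ ε x, (v ε).app a x = z := fun a z =>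
    (jointly_surjective_of_isColimit_binaryCofan hv a z).elim (fun h => ⟨0, h⟩) (fun h => ⟨1, h⟩)
  have hd' : ∀ a ε x, (d ≫ (cylinderObjIso K).hom).app a ((u ε).app a x) =
      ((intervalEndIncl ε).app K).app a x := fun a ε x => by
    rw [← δ_cylinderObjIso, ← hd]; rfl
  have he' : ∀ a ε x, (e ≫ (cylinderObjIso L).hom).app a ((v ε).app a x) =
      ((intervalEndIncl ε).app L).app a x := fun a ε x => by
    rw [← δ_cylinderObjIso, ← he]; rfl
  have hg' : ∀ a ε x, g.app a ((u ε).app a x) = (v ε).app a (f.app a x) := fun a ε x =>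
    ConcreteCategory.congr_hom (congr_app (hg ε) a) x
  -- The two ends are disjoint: `[n]` is nonempty, so a constant level determines its value, read
  -- off at the index `0`.
  have hconst : ∀ (X : SSetIsov) (a : GDeltaᵒᵖ) (ε ε' : Fin 2) (x x' : X.obj a),
      ((intervalEndIncl ε).app X).app a x = ((intervalEndIncl ε').app X).app a x' →
        ε = ε' ∧ x = x' := fun X a ε ε' x x' h => by
    obtain ⟨h, h'⟩ := Prod.mk.inj h
    exact ⟨congrArg (fun t : Fin (a.unop.n + 1) →o Fin 2 => t 0) h, h'⟩
  let k : E ⟶ (unionProd intervalBdry (Subfunctor.range f)).toFunctor :=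
    Subfunctor.lift (e ≫ (cylinderObjIso L).hom) (by
      rintro a _ ⟨z, rfl⟩
      obtain ⟨ε, x, rfl⟩ := hv' a z
      rw [he']
      exact Or.inl ⟨ε, fun _ => rfl⟩)
  have hk : ∀ a ε x, ((k.app a ((v ε).app a x)).1) = ((intervalEndIncl ε).app L).app a x := he'
  refine mem_of_isPushout hW sq (k := k) ?_ φ h₁ ?_
  · refine isPushout_of_elementwise ?_ (unionProdCyl_injective _ f) ?_ ?_ ?_ ?_
    · ext a z
      obtain ⟨ε, x, rfl⟩ := hu' a z
      refine Subtype.ext ?_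
      change (MonoidalCategory.whiskerLeft interval f).app a
        ((d ≫ (cylinderObjIso K).hom).app a ((u ε).app a x)) = (k.app a (g.app a _)).1
      rw [hd', hg', hk]
      rfl
    · intro a x y h _
      obtain ⟨ε, x, rfl⟩ := hu' a x
      obtain ⟨ε', y, rfl⟩ := hu' a y
      rw [hd', hd'] at h
      obtain ⟨rfl, rfl⟩ := hconst _ _ _ _ _ _ h
      rfl
    · rintro a ⟨⟨t, x⟩, ⟨ε, h⟩ | ⟨y, hy⟩⟩
      · refine Or.inr ⟨(v ε).app a x, Subtype.ext ((hk a ε x).trans (Prod.ext ?_ rfl))⟩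
        exact OrderHom.ext _ _ (funext fun s => (h s).symm)
      · exact Or.inl ⟨(t, y), Subtype.ext (congrArg (Prod.mk t) hy)⟩
    · rintro a ⟨t, x⟩ z h
      obtain ⟨ε, y, rfl⟩ := hv' a z
      have h' := (congrArg Subtype.val h).trans (hk a ε y)
      obtain rfl : f.app a x = y := (Prod.mk.inj h').2
      exact ⟨(u ε).app a x, hg' a ε x⟩
    · rintro a z z' - - h
      obtain ⟨ε, x, rfl⟩ := hv' a z
      obtain ⟨ε', y, rfl⟩ := hv' a z'
      obtain ⟨rfl, rfl⟩ := hconst _ _ _ _ _ _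
        ((hk a ε x).symm.trans ((congrArg Subtype.val h).trans (hk a ε' y)))
      rfl
  · rw [reassoc_of% h₂]
    rfl

end Isov

namespace Isov

/-! ### The axioms over a base -/

section Over

variable {C : Type} [Category.{0} C] {ι : Type} {D E : ι → (Cᵒᵖ ⥤ Type)}

/-- The morphisms over `B` with underlying morphism in a given family. -/
def overFamily (f : ∀ i, D i ⟶ E i) (B : Cᵒᵖ ⥤ Type) : MorphismProperty (Over B) :=
  MorphismProperty.ofHoms (fun p : Σ i, (E i ⟶ B) =>
    (Over.homMk (f p.1) : Over.mk (f p.1 ≫ p.2) ⟶ Over.mk p.2))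

theorem overFamily_rlp_iff (f : ∀ i, D i ⟶ E i) {B : Cᵒᵖ ⥤ Type} {U V : Over B} (p : U ⟶ V) :
    (overFamily f B).rlp p ↔ (MorphismProperty.ofHoms f).rlp p.left := by
  constructor
  · rintro hp _ _ _ ⟨i⟩
    refine ⟨fun {u v} sq => ?_⟩
    let g : Over.mk (f i ≫ v ≫ V.hom) ⟶ Over.mk (v ≫ V.hom) := Over.homMk (f i)
    have := hp g (⟨(⟨i, v ≫ V.hom⟩ : Σ i, (E i ⟶ B))⟩)
    have sq' : CommSq (Over.homMk u (by
        have := sq.w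
        dsimp
        rw [← reassoc_of% this, Over.w]) : Over.mk (f i ≫ v ≫ V.hom) ⟶ U) g p
        (Over.homMk v : Over.mk (v ≫ V.hom) ⟶ V) := ⟨by ext1; exact sq.w⟩
    exact ⟨⟨sq'.lift.left, congrArg (fun q => q.left) sq'.fac_left,
      congrArg (fun q => q.left) sq'.fac_right⟩⟩
  · rintro hp _ _ _ ⟨i⟩
    have : HasLiftingProperty
        (Over.homMk (f i.1) : Over.mk (f i.1 ≫ i.2) ⟶ Over.mk i.2).left p.left := hp _ ⟨i.1⟩
    exact HasLiftingProperty.over _ _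

/-- Lifts over `B` are lifts of underlying maps. For the converse, factor the underlying map and
regard the factorization as one over `B`; lifting against its second factor makes the map a retract
of the first. -/
theorem overFamily_rlp_llp (f : ∀ i, D i ⟶ E i) (B : Cᵒᵖ ⥤ Type) :
    (MorphismProperty.ofHoms f).rlp.llp.inverseImage (Over.forget B) =
      (overFamily f B).rlp.llp := by
  refine le_antisymm ?_ ?_
  · intro K L g hg X Y p hp
    have : HasLiftingProperty g.left p.left := hg _ ((overFamily_rlp_iff f p).1 hp)
    exact HasLiftingProperty.over _ _
  · intro K L g hg
    have := hasSmallObjectArgument_ofHoms f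
    let F := MorphismProperty.factorizationData (MorphismProperty.ofHoms f).rlp.llp
      (MorphismProperty.ofHoms f).rlp g.left
    let i : K ⟶ Over.mk (F.p ≫ L.hom) := Over.homMk F.i
    let q : Over.mk (F.p ≫ L.hom) ⟶ L := Over.homMk F.p
    have h : i ≫ q = g := by ext1; exact F.fac
    have := hg q ((overFamily_rlp_iff f q).2 F.hp)
    have r := (RetractArrow.ofLeftLiftingProperty h).map (Over.forget B)
    change (MorphismProperty.ofHoms f).rlp.llp g.left
    exact MorphismProperty.of_retract r F.hi

end Over

/-- Anodyne extensions are monomorphisms, so the map may be replaced by the inclusion of its image,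
to which the pushout-product result applies. -/
theorem isovariantAnodyne_bdryMap {X Y : SSetIsov} (f : X ⟶ Y) (hf : isovariantAnodyne f) :
    isovariantAnodyne (cylinder.bdryMap f) := by
  have : Mono f := isovariantAnodyne_le_monomorphisms _ hf
  rw [isovariantAnodyne_eq] at hf ⊢
  have hl : ∀ {X : SSetIsov} (ε : Fin 2), (![coprod.inl, coprod.inr] : Fin 2 → (X ⟶ X ⨿ X)) ε ≫
      cylinder.bdry X = (cylinder.δ ε).app X :=
    Fin.forall_fin_two.2
      ⟨coprod.inl_desc _ _,
        coprod.inr_desc _ _⟩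
  exact mem_of_isPushout_bdry (f := f)
    (anodyneLLP_unionProd_bdry _ ((mem_iff_range_ι_mem f).1 hf))
    (coprodIsCoprod X X) (coprodIsCoprod Y Y) hl hl (g := coprod.map f f) (Fin.forall_fin_two.2
      ⟨coprod.inl_map f f, coprod.inr_map f f⟩) (IsPushout.of_hasPushout _ _) _
    (pushout.inl_desc _ _ _) (pushout.inr_desc _ _ _)

theorem isAnodyneClass_fiberwiseAnodyne {B : SSetIsov} (hB : IsNormal B) :
    (cylinder.overCylinder B).IsAnodyneClass (fiberwiseAnodyne B) where
  an0 := by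
    refine ⟨overFamily (fun p : {p : HornIndex // p.IsAdmissible} => p.1.horn.ι) B,
      MorphismProperty.isSmall_ofHoms _, ?_, ?_⟩
    · rintro _ _ _ ⟨p⟩
      exact Over.mono_of_mono_left _
    · rw [fiberwiseAnodyne, isovariantAnodyne_eq]
      exact overFamily_rlp_llp _ B
  an1 ε {K L} f hf := by
    have : Mono f.left := inferInstance
    -- The forgetful functor preserves pushouts but need not hit the chosen ones; the comparison
    -- with unions accepts any pushout square.
    have sq := (IsPushout.of_hasPushout (((cylinder.overCylinder B).δ ε).app K) f).map
      (Over.forget B)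
    have h : anodyneLLP ((cylinder.overCylinder B).endMap ε f).left :=
      mem_of_isPushout_end (f := f.left) (ε := ε)
        -- Normality of the base enters here, through freeness of the total object of `L`.
        (anodyneLLP_unionProd_end (hB.isFree.of_hom L.hom) _ ε) sq _
        (congrArg Over.Hom.left (pushout.inl_desc _ _ _))
        (congrArg Over.Hom.left (pushout.inr_desc _ _ _))
    rw [fiberwiseAnodyne, isovariantAnodyne_eq]
    exact h
  an2 {K L} f hf := by
    have hm : Mono f.left := isovariantAnodyne_le_monomorphisms _ hf
    rw [fiberwiseAnodyne, isovariantAnodyne_eq] at hf ⊢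
    have hf : anodyneLLP f.left := hf
    have sq := (IsPushout.of_hasPushout ((cylinder.overCylinder B).bdry K) (coprod.map f f)).map
      (Over.forget B)
    have hl : ∀ {X : Over B} (ε : Fin 2), (![(coprod.inl : X ⟶ X ⨿ X).left,
        (coprod.inr : X ⟶ X ⨿ X).left] : Fin 2 → (X.left ⟶ (X ⨿ X).left)) ε ≫
          ((cylinder.overCylinder B).bdry X).left = (cylinder.δ ε).app X.left :=
    Fin.forall_fin_two.2
      ⟨congrArg Over.Hom.left (coprod.inl_desc _ _),
        congrArg Over.Hom.left (coprod.inr_desc _ _)⟩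
    have hc : ∀ X : Over B, IsColimit (BinaryCofan.mk (coprod.inl : X ⟶ X ⨿ X).left
        (coprod.inr : X ⟶ X ⨿ X).left) := fun X =>
      mapIsColimitOfPreservesOfIsColimit (Over.forget B) _ _ (coprodIsCoprod X X)
    have h : anodyneLLP ((cylinder.overCylinder B).bdryMap f).left :=
      mem_of_isPushout_bdry (f := f.left)
        (anodyneLLP_unionProd_bdry _ ((mem_iff_range_ι_mem f.left).1 hf))
        (hc K) (hc L) hl hl
        (g := (coprod.map f f).left) (Fin.forall_fin_two.2
          ⟨congrArg Over.Hom.left (coprod.inl_map f f),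
            congrArg Over.Hom.left (coprod.inr_map f f)⟩) sq _
        (congrArg Over.Hom.left (pushout.inl_desc _ _ _))
        (congrArg Over.Hom.left (pushout.inr_desc _ _ _))
    exact h

end Isov

theorem mainTheorem5 :
    (∀ B : Isov.SSetIsov, Isov.IsNormal B →
      (Isov.cylinder.overCylinder B).IsAnodyneClass (Isov.fiberwiseAnodyne B)) ∧
    (∀ (X Y : Isov.SSetIsov) (f : X ⟶ Y), Isov.isovariantAnodyne f →
      Isov.isovariantAnodyne (Isov.cylinder.bdryMap f)) :=
  ⟨fun _ hB => Isov.isAnodyneClass_fiberwiseAnodyne hB,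
    fun _ _ f hf => Isov.isovariantAnodyne_bdryMap f hf⟩
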